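/- **Setting.** A *diagram* on $n$ strands is a partition $a$ of $n$ top points and $n$ bottom points placed on the boundary of a rectangle; it is *planar* if no two of its blocks cross. Placing $a$ on top of $b$ and identifying the bottom points of $a$ with the top points of $b$ gives a diagram $ab$ (the connected components, restricted to the outer points) and a number $\Phi(a,b)\ge 0$ of internal components (those containing only middle points). The pairs $(a,i)$ with $a$ a diagram on $n$ strands and $i\in\mathbb Z/m$ form a monoid under $(a,i)(b,j)=(ab,\,i+j+\Phi(a,b))$. The *$m$-cyclic planar partition monoid* $m\mathcal{PP}a_n$ is the submonoid of the pairs with $a$ planar, and the *$m$-cyclic Temperley–Lieb monoid* $m\mathcal{TL}_n$ is the submonoid of the pairs with $a$ planar and all blocks of size two. The *through strands* of $(a,i)$ are the blocks of $a$ meeting both the top and the bottom. For $\mathcal S$ one of these monoids, the truncation $\mathcal S^{k\le l}$ is the Rees factor of the submonoid consisting of $1$ and all elements with at most $l$ through strands by the ideal of elements with fewer than $k$ through strands (this ideal is collapsed to a zero element). For a monoid $\mathcal S$ and a field $\mathbb K$, let $\mathbb 1_t$ be the one-dimensional representation on which every element acts by $1$, and $\mathbb 1_b$ the one on which units act by $1$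 and all other elements by $0$. The pair $(\mathcal S,\mathbb K)$ is *$d$-trivial* if every $\mathcal S$-representation over $\mathbb K$ of dimension at most $d$ is isomorphic to a direct sum of copies of $\mathbb 1_t$ and $\mathbb 1_b$; by convention the trivial group and the monoid $\{1,a\}$ with $a^2=a$ are only $(-1)$-trivial. The *representation gap* is $\operatorname{gap}_{\mathbb K}(\mathcal S)=\sup\{g\in\mathbb{Z}_{\ge 0}\mid (\mathcal S,\mathbb K)\text{ is }(g-1)\text{-trivial}\}$ (a maximum whenever it is finite). **Theorem.** Let $m,n,k,l$ be natural numbers with $1\le k\le l<n$, and let $\mathbb K$ be a field with $\operatorname{char}\mathbb K\nmid 2m$. Then $$\operatorname{gap}_{\mathbb K}\bigl(m\mathcal{PP}a_n^{\,k\le l}\bigr)\le \operatorname{gap}_{\mathbb K}\bigl(2m\mathcal{TL}_{2n}^{\,2k\le 2l}\bigr).$$ -/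

import Mathlib

namespace CyclicDiagram

section Gluing

variable {α β γ δ : Type}

/-- The part `α ⊕ β` (upper diagram) of the three layers `α`, `β`, `γ`. -/
def upper : α ⊕ β → α ⊕ (β ⊕ γ) := Sum.map id Sum.inl

/-- The part `β ⊕ γ` (lower diagram) of the three layers `α`, `β`, `γ`. -/
def lower : β ⊕ γ → α ⊕ (β ⊕ γ) := Sum.inr

/-- The outer layers `α ⊕ γ` of the three layers `α`, `β`, `γ`. -/
def outer : α ⊕ γ → α ⊕ (β ⊕ γ) := Sum.map id Sum.inr

/-- Gluing `a` on top of `b` along the middle points `β`: the partition of the three layers of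
points into the connected components of the glued picture. -/
def stack (a : Setoid (α ⊕ β)) (b : Setoid (β ⊕ γ)) : Setoid (α ⊕ (β ⊕ γ)) :=
  a.map upper ⊔ b.map lower

/-- The composite of two partition diagrams (`a` on top of `b`), internal components removed. -/
def comp (a : Setoid (α ⊕ β)) (b : Setoid (β ⊕ γ)) : Setoid (α ⊕ γ) :=
  (stack a b).comap outer

/-- The number of internal components created by gluing `a` on top of `b`: the components that
meet neither the top nor the bottom layer. -/
noncomputable def internal (a : Setoid (α ⊕ β)) (b : Setoid (β ⊕ γ)) : ℕ :=
  {s | s ∈ (stack a b).classes ∧ ∀ x, outer x ∉ s}.ncard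

/-- The identity diagram: each top point is joined to the bottom point below it. -/
def idDiagram (α : Type) : Setoid (α ⊕ α) := Setoid.ker (Sum.elim id id)

/-! Auxiliary facts: associativity of gluing, and the count of internal components. -/

theorem map_le_iff {X Y : Type} {r : Setoid X} {f : X → Y} {s : Setoid Y} :
    r.map f ≤ s ↔ r ≤ s.comap f := by
  constructor
  · intro h x y hxy
    exact h (Relation.EqvGen.rel _ _ ⟨x, y, hxy, rfl, rfl⟩)
  · intro h
    refine Setoid.eqvGen_le ?_
    rintro _ _ ⟨u, v, huv, rfl, rfl⟩
    exact h huv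

theorem map_map' {X Y Z : Type} (r : Setoid X) (f : X → Y) (g : Y → Z) :
    (r.map f).map g = r.map (g ∘ f) :=
  eq_of_forall_ge_iff fun s => by
    rw [map_le_iff, map_le_iff, map_le_iff]; rfl

theorem map_sup' {X Y : Type} (r s : Setoid X) (f : X → Y) :
    (r ⊔ s).map f = r.map f ⊔ s.map f :=
  eq_of_forall_ge_iff fun t => by
    rw [map_le_iff, sup_le_iff, sup_le_iff, map_le_iff, map_le_iff]

theorem map_rel_of_injective {X Y : Type} (r : Setoid X) {f : X → Y}
    (hf : Function.Injective f) {x y : Y} :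
    r.map f x y ↔ (∃ u v, r u v ∧ f u = x ∧ f v = y) ∨ x = y := by
  have h := Setoid.coe_map_of_ker_le r f (fun u v huv => by
    have := hf huv; subst this; exact r.refl' _)
  exact iff_of_eq (congrFun (congrFun h x) y)

/-- Joining `r` with a relation living on a part: explicit description. -/
theorem sup_map_rel {X Y : Type} (r : Setoid X) (s : Setoid Y) (f : Y → X) {x y : X} :
    (r ⊔ s.map f) x y ↔
      r x y ∨ ∃ u v, r x (f u) ∧ (r.comap f ⊔ s) u v ∧ r (f v) y := by
  constructor
  · let E : Setoid X :=
      { r := fun x y => r x y ∨ ∃ u v, r x (f u) ∧ (r.comap f ⊔ s) u v ∧ r (f v) y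
        iseqv := by
          refine ⟨fun x => Or.inl (r.refl' x), ?_, ?_⟩
          · rintro x y (h | ⟨u, v, h1, h2, h3⟩)
            · exact Or.inl (r.symm' h)
            · exact Or.inr ⟨v, u, r.symm' h3, Setoid.symm' _ h2, r.symm' h1⟩
          · rintro x y z (h | ⟨u, v, h1, h2, h3⟩) (h' | ⟨u', v', h1', h2', h3'⟩)
            · exact Or.inl (r.trans' h h')
            · exact Or.inr ⟨u', v', r.trans' h h1', h2', h3'⟩
            · exact Or.inr ⟨u, v, h1, h2, r.trans' h3 h'⟩
            · refine Or.inr ⟨u, v', h1, Setoid.trans' _ h2 (Setoid.trans' _ ?_ h2'), h3'⟩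
              exact (le_sup_left : r.comap f ≤ r.comap f ⊔ s) (r.trans' h3 h1') }
    have hE : r ⊔ s.map f ≤ E := by
      refine sup_le (fun x y h => Or.inl h) (map_le_iff.2 fun u v h => ?_)
      exact Or.inr ⟨u, v, r.refl' _, (le_sup_right : s ≤ r.comap f ⊔ s) h, r.refl' _⟩
    exact fun h => hE h
  · have hr : r ≤ r ⊔ s.map f := le_sup_left
    have hs : r.comap f ⊔ s ≤ (r ⊔ s.map f).comap f :=
      sup_le (fun u v h => hr h) (map_le_iff.1 le_sup_right)
    rintro (h | ⟨u, v, h1, h2, h3⟩)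
    · exact hr h
    · exact Setoid.trans' _ (hr h1) (Setoid.trans' _ (hs h2) (hr h3))

theorem comap_sup_map {X Y : Type} (r : Setoid X) (s : Setoid Y) (f : Y → X) :
    (r ⊔ s.map f).comap f = r.comap f ⊔ s := by
  refine le_antisymm (fun u v h => ?_) ?_
  · rcases (sup_map_rel r s f).1 h with h | ⟨u', v', h1, h2, h3⟩
    · exact (le_sup_left : r.comap f ≤ r.comap f ⊔ s) h
    · have hl : r.comap f ≤ r.comap f ⊔ s := le_sup_left
      exact Setoid.trans' _ (hl h1) (Setoid.trans' _ h2 (hl h3))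
  · exact sup_le (fun u v h => (le_sup_left : r ≤ r ⊔ s.map f) h) (map_le_iff.1 le_sup_right)

theorem comap_map_square {W X Y Z : Type} (r : Setoid X) {i : X → Z} {j : Y → Z} {p : W → X}
    {q : W → Y} (hi : Function.Injective i) (hj : Function.Injective j)
    (hq : Function.Injective q) (hsq : ∀ w, i (p w) = j (q w))
    (hpb : ∀ x y, i x = j y → ∃ w, p w = x ∧ q w = y) :
    (r.map i).comap j = (r.comap p).map q := by
  refine Setoid.ext fun y y' => ?_
  rw [Setoid.comap_rel, map_rel_of_injective r hi, map_rel_of_injective _ hq]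
  constructor
  · rintro (⟨u, v, huv, hu, hv⟩ | h)
    · obtain ⟨w, rfl, rfl⟩ := hpb u y hu
      obtain ⟨w', rfl, rfl⟩ := hpb v y' hv
      exact Or.inl ⟨w, w', huv, rfl, rfl⟩
    · exact Or.inr (hj h)
  · rintro (⟨u, v, huv, rfl, rfl⟩ | h)
    · exact Or.inl ⟨p u, p v, huv, hsq u, hsq v⟩
    · exact Or.inr (congrArg j h)

/-- The classes of `r` that miss the image of `f`. -/
def missed {X Y : Type} (r : Setoid X) (f : Y → X) : Set (Set X) :=
  {s | s ∈ r.classes ∧ ∀ y, f y ∉ s}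

theorem missed_sup_map {X Y : Type} (r : Setoid X) (s : Setoid Y) (f : Y → X) :
    missed (r ⊔ s.map f) f = missed r f := by
  have key : ∀ x : X, (∀ y, ¬ r (f y) x) →
      {z | (r ⊔ s.map f) z x} = {z | r z x} := by
    intro x hx
    ext z
    simp only [Set.mem_ofPred_eq]
    rw [sup_map_rel]
    constructor
    · rintro (h | ⟨u, v, _, _, h⟩)
      · exact h
      · exact absurd h (hx v)
    · exact Or.inl
  ext t
  constructor
  · rintro ⟨⟨x, rfl⟩, h⟩
    have hx : ∀ y, ¬ r (f y) x := fun y hy => h y ((le_sup_left : r ≤ r ⊔ s.map f) hy)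
    refine ⟨⟨x, key x hx⟩, h⟩
  · rintro ⟨⟨x, rfl⟩, h⟩
    exact ⟨⟨x, (key x h).symm⟩, h⟩

theorem ncard_missed_map_square {W X Y Z : Type} (r : Setoid X) {i : X → Z} {j : Y → Z}
    {p : W → X} (q : W → Y) (hi : Function.Injective i)
    (hsq : ∀ w, i (p w) = j (q w))
    (hpb : ∀ x y, i x = j y → ∃ w, p w = x ∧ q w = y)
    (hcov : ∀ z, (∃ x, i x = z) ∨ ∃ y, j y = z) :
    (missed (r.map i) j).ncard = (missed r p).ncard := by
  have hcl : ∀ x : X, {z | r.map i z (i x)} = i '' {x' | r x' x} := by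
    intro x
    ext z
    simp only [Set.mem_ofPred_eq, Set.mem_image]
    rw [map_rel_of_injective r hi]
    constructor
    · rintro (⟨u, v, h, rfl, hv⟩ | rfl)
      · exact ⟨u, hi hv ▸ h, rfl⟩
      · exact ⟨x, r.refl' x, rfl⟩
    · rintro ⟨x', h, rfl⟩
      exact Or.inl ⟨x', x, h, rfl, rfl⟩
  have : missed (r.map i) j = (fun s => i '' s) '' missed r p := by
    ext t
    constructor
    · rintro ⟨⟨z, rfl⟩, h⟩
      rcases hcov z with ⟨x, rfl⟩ | ⟨y, rfl⟩
      · refine ⟨{x' | r x' x}, ⟨⟨x, rfl⟩, fun w hw => h (q w) ?_⟩, (hcl x).symm⟩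
        rw [hcl, ← hsq]
        exact ⟨_, hw, rfl⟩
      · exact absurd (Setoid.refl' (r.map i) (j y)) (h y)
    · rintro ⟨_, ⟨⟨x, rfl⟩, h⟩, rfl⟩
      refine ⟨⟨i x, (hcl x).symm⟩, ?_⟩
      rintro y ⟨x', hx', he⟩
      obtain ⟨w, rfl, rfl⟩ := hpb x' y he
      exact h w hx'
  rw [this]
  exact Set.ncard_image_of_injective _ (Set.image_injective.2 hi)

theorem ncard_missed_comp {X Y Z : Type} [Finite X] (r : Setoid X) (f : Y → X) (g : Z → Y) :
    (missed r (f ∘ g)).ncard = (missed r f).ncard + (missed (r.comap f) g).ncard := by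
  have h1 : missed r (f ∘ g) = missed r f ∪ {s | s ∈ missed r (f ∘ g) ∧ ∃ y, f y ∈ s} := by
    ext s
    constructor
    · intro h
      by_cases hs : ∃ y, f y ∈ s
      · exact Or.inr ⟨h, hs⟩
      · exact Or.inl ⟨h.1, fun y hy => hs ⟨y, hy⟩⟩
    · rintro (h | h)
      · exact ⟨h.1, fun z => h.2 (g z)⟩
      · exact h.1
  rw [h1, Set.ncard_union_eq ?_ (Set.toFinite _) (Set.toFinite _)]
  · congr 1
    have : missed (r.comap f) g =
        (fun s => f ⁻¹' s) '' {s | s ∈ missed r (f ∘ g) ∧ ∃ y, f y ∈ s} := by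
      ext t
      constructor
      · rintro ⟨⟨y, rfl⟩, h⟩
        exact ⟨{x | r x (f y)}, ⟨⟨⟨f y, rfl⟩, h⟩, ⟨y, r.refl' _⟩⟩, rfl⟩
      · rintro ⟨_, ⟨⟨⟨x, rfl⟩, h⟩, ⟨y, hy⟩⟩, rfl⟩
        refine ⟨⟨y, ?_⟩, h⟩
        ext y'
        exact ⟨fun h' => r.trans' h' (r.symm' hy), fun h' => r.trans' h' hy⟩
    rw [this]
    refine (Set.InjOn.ncard_image ?_).symm
    rintro _ ⟨⟨⟨x, rfl⟩, _⟩, ⟨y, hy⟩⟩ _ ⟨⟨⟨x', rfl⟩, _⟩, _⟩ he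
    have hy' : r (f y) x' := by
      have : y ∈ f ⁻¹' {z | r z x'} := (congrArg (fun t => y ∈ t) he).mp hy
      exact this
    have hxx : r x x' := r.trans' (r.symm' hy) hy'
    ext z
    exact ⟨fun h' => r.trans' h' hxx, fun h' => r.trans' h' (r.symm' hxx)⟩
  · rw [Set.disjoint_left]
    rintro s hs ⟨_, y, hy⟩
    exact hs.2 y hy

theorem upper_injective : Function.Injective (upper : α ⊕ β → α ⊕ (β ⊕ γ)) := by
  rintro (x | x) (y | y) h <;> simp_all [upper]

theorem lower_injective : Function.Injective (lower : β ⊕ γ → α ⊕ (β ⊕ γ)) := Sum.inr_injective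

theorem outer_injective : Function.Injective (outer : α ⊕ γ → α ⊕ (β ⊕ γ)) := by
  rintro (x | x) (y | y) h <;> simp_all [outer]

theorem internal_eq_missed (a : Setoid (α ⊕ β)) (b : Setoid (β ⊕ γ)) :
    internal a b = (missed (stack a b) outer).ncard := rfl

/-- Embedding of the layers `α`, `β`, `γ` into four layers. -/
def i123 : α ⊕ (β ⊕ γ) → α ⊕ (β ⊕ (γ ⊕ δ)) := Sum.map id (Sum.map id Sum.inl)
/-- Embedding of the layers `α`, `γ`, `δ` into four layers. -/
def i134 : α ⊕ (γ ⊕ δ) → α ⊕ (β ⊕ (γ ⊕ δ)) := Sum.map id Sum.inr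
/-- Embedding of the layers `α`, `β`, `δ` into four layers. -/
def i124 : α ⊕ (β ⊕ δ) → α ⊕ (β ⊕ (γ ⊕ δ)) := Sum.map id (Sum.map id Sum.inr)
/-- Embedding of the layers `β`, `γ`, `δ` into four layers. -/
def i234 : β ⊕ (γ ⊕ δ) → α ⊕ (β ⊕ (γ ⊕ δ)) := Sum.inr

/-- Three diagrams glued along two middle layers. -/
def stack3 (a : Setoid (α ⊕ β)) (b : Setoid (β ⊕ γ)) (c : Setoid (γ ⊕ δ)) :
    Setoid (α ⊕ (β ⊕ (γ ⊕ δ))) :=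
  a.map upper ⊔ (b.map upper ⊔ c.map lower).map i234

theorem stack3_left (a : Setoid (α ⊕ β)) (b : Setoid (β ⊕ γ)) (c : Setoid (γ ⊕ δ)) :
    stack3 a b c = (stack a b).map i123 ⊔ (c.map lower).map i134 := by
  unfold stack3 stack
  rw [map_sup', map_sup', map_map', map_map', map_map', map_map', map_map', ← sup_assoc]
  congr 1
  congr 1
  · congr 1; funext x; rcases x with x | x <;> rfl

theorem stack3_right (a : Setoid (α ⊕ β)) (b : Setoid (β ⊕ γ)) (c : Setoid (γ ⊕ δ)) :
    stack3 a b c = (stack b c).map i234 ⊔ (a.map upper).map i124 := by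
  unfold stack3 stack
  rw [sup_comm, map_map' a]
  congr 2
  funext x; rcases x with x | x <;> rfl

theorem sq_left (w : α ⊕ γ) : (i123 (outer w) : α ⊕ (β ⊕ (γ ⊕ δ))) = i134 (upper w) := by
  rcases w with w | w <;> rfl

theorem sq_right (w : β ⊕ δ) : (i234 (outer w) : α ⊕ (β ⊕ (γ ⊕ δ))) = i124 (lower w) := by
  rcases w with w | w <;> rfl

theorem pb_left (x : α ⊕ (β ⊕ γ)) (y : α ⊕ (γ ⊕ δ)) (h : i123 x = i134 y) :
    ∃ w, outer w = x ∧ upper w = y := by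
  rcases x with x | x | x <;> rcases y with y | y | y <;> simp [i123, i134] at h
  · exact ⟨Sum.inl x, rfl, by subst h; rfl⟩
  · exact ⟨Sum.inr x, rfl, by subst h; rfl⟩

theorem pb_right (x : β ⊕ (γ ⊕ δ)) (y : α ⊕ (β ⊕ δ)) (h : i234 x = i124 y) :
    ∃ w, outer w = x ∧ lower w = y := by
  rcases x with x | x | x <;> rcases y with y | y | y <;> simp [i234, i124] at h
  · exact ⟨Sum.inl x, rfl, by subst h; rfl⟩
  · exact ⟨Sum.inr x, rfl, by subst h; rfl⟩

theorem i123_injective : Function.Injective (i123 : _ → α ⊕ (β ⊕ (γ ⊕ δ))) := by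
  rintro (x | x | x) (y | y | y) h <;> simp_all [i123]

theorem i134_injective : Function.Injective (i134 : _ → α ⊕ (β ⊕ (γ ⊕ δ))) := by
  rintro (x | x | x) (y | y | y) h <;> simp_all [i134]

theorem i124_injective : Function.Injective (i124 : _ → α ⊕ (β ⊕ (γ ⊕ δ))) := by
  rintro (x | x | x) (y | y | y) h <;> simp_all [i124]

theorem i234_injective : Function.Injective (i234 : _ → α ⊕ (β ⊕ (γ ⊕ δ))) := Sum.inr_injective

theorem cov_left (z : α ⊕ (β ⊕ (γ ⊕ δ))) : (∃ x, i123 x = z) ∨ ∃ y, i134 y = z := by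
  rcases z with z | z | z | z
  · exact Or.inl ⟨Sum.inl z, rfl⟩
  · exact Or.inl ⟨Sum.inr (Sum.inl z), rfl⟩
  · exact Or.inl ⟨Sum.inr (Sum.inr z), rfl⟩
  · exact Or.inr ⟨Sum.inr (Sum.inr z), rfl⟩

theorem cov_right (z : α ⊕ (β ⊕ (γ ⊕ δ))) : (∃ x, i234 x = z) ∨ ∃ y, i124 y = z := by
  rcases z with z | z
  · exact Or.inr ⟨Sum.inl z, rfl⟩
  · exact Or.inl ⟨z, rfl⟩

theorem comap_stack3_left (a : Setoid (α ⊕ β)) (b : Setoid (β ⊕ γ)) (c : Setoid (γ ⊕ δ)) :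
    (stack3 a b c).comap i134 = stack (comp a b) c := by
  rw [stack3_left, comap_sup_map, comap_map_square (stack a b) i123_injective i134_injective
    upper_injective sq_left pb_left]
  rfl

theorem comap_stack3_right (a : Setoid (α ⊕ β)) (b : Setoid (β ⊕ γ)) (c : Setoid (γ ⊕ δ)) :
    (stack3 a b c).comap i124 = stack a (comp b c) := by
  rw [stack3_right, comap_sup_map, comap_map_square (stack b c) i234_injective i124_injective
    lower_injective sq_right pb_right, sup_comm]
  rfl

theorem outer_left : (i134 ∘ outer : α ⊕ δ → α ⊕ (β ⊕ (γ ⊕ δ))) = i124 ∘ outer := by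
  funext x; rcases x with x | x <;> rfl

theorem comp_assoc (a : Setoid (α ⊕ β)) (b : Setoid (β ⊕ γ)) (c : Setoid (γ ⊕ δ)) :
    comp (comp a b) c = comp a (comp b c) := by
  change (stack (comp a b) c).comap outer = (stack a (comp b c)).comap outer
  rw [← comap_stack3_left, ← comap_stack3_right]
  change (stack3 a b c).comap (i134 ∘ outer) = (stack3 a b c).comap (i124 ∘ outer)
  rw [outer_left]

theorem internal_assoc [Finite α] [Finite β] [Finite γ] [Finite δ]
    (a : Setoid (α ⊕ β)) (b : Setoid (β ⊕ γ)) (c : Setoid (γ ⊕ δ)) :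
    internal a b + internal (comp a b) c = internal b c + internal a (comp b c) := by
  have hl : (missed (stack3 a b c) (i134 ∘ outer)).ncard =
      internal a b + internal (comp a b) c := by
    rw [ncard_missed_comp, comap_stack3_left, internal_eq_missed (comp a b), stack3_left,
      missed_sup_map, ncard_missed_map_square (stack a b) upper i123_injective sq_left pb_left
        cov_left]
    rfl
  have hr : (missed (stack3 a b c) (i124 ∘ outer)).ncard =
      internal b c + internal a (comp b c) := by
    rw [ncard_missed_comp, comap_stack3_right, internal_eq_missed a, stack3_right,
      missed_sup_map, ncard_missed_map_square (stack b c) lower i234_injective sq_right pb_right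
        cov_right]
    rfl
  rw [← hl, ← hr, outer_left]

theorem stack_upper (a : Setoid (α ⊕ β)) (b : Setoid (β ⊕ γ)) {x y : α ⊕ β} (h : a x y) :
    stack a b (upper x) (upper y) :=
  (le_sup_left : a.map upper ≤ stack a b) (Relation.EqvGen.rel _ _ ⟨x, y, h, rfl, rfl⟩)

theorem stack_lower (a : Setoid (α ⊕ β)) (b : Setoid (β ⊕ γ)) {x y : β ⊕ γ} (h : b x y) :
    stack a b (lower x) (lower y) :=
  (le_sup_right : b.map lower ≤ stack a b) (Relation.EqvGen.rel _ _ ⟨x, y, h, rfl, rfl⟩)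

theorem stack_le {a : Setoid (α ⊕ β)} {b : Setoid (β ⊕ γ)} {r : Setoid (α ⊕ (β ⊕ γ))}
    (ha : a ≤ r.comap upper) (hb : b ≤ r.comap lower) : stack a b ≤ r :=
  sup_le (map_le_iff.2 ha) (map_le_iff.2 hb)

theorem internal_eq_zero (a : Setoid (α ⊕ β)) (b : Setoid (β ⊕ γ))
    (h : ∀ j : β, ∃ x, stack a b (outer x) (Sum.inr (Sum.inl j))) : internal a b = 0 := by
  have : {s | s ∈ (stack a b).classes ∧ ∀ x, outer x ∉ s} = ∅ := by
    rw [Set.eq_empty_iff_forall_notMem]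
    rintro _ ⟨⟨x, rfl⟩, hs⟩
    rcases x with x | x | x
    · exact hs (Sum.inl x) (Setoid.refl' (stack a b) _)
    · obtain ⟨y, hy⟩ := h x
      exact hs y hy
    · exact hs (Sum.inr x) (Setoid.refl' (stack a b) _)
  rw [internal, this, Set.ncard_empty]

theorem id_stack_rel (a : Setoid (α ⊕ β)) (i : α) :
    stack (idDiagram α) a (Sum.inl i) (Sum.inr (Sum.inl i)) :=
  stack_upper (idDiagram α) a (x := Sum.inl i) (y := Sum.inr i) rfl

theorem stack_id_rel (a : Setoid (α ⊕ β)) (i : β) :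
    stack a (idDiagram β) (Sum.inr (Sum.inr i)) (Sum.inr (Sum.inl i)) :=
  stack_lower a (idDiagram β) (x := Sum.inr i) (y := Sum.inl i) rfl

theorem id_comp (a : Setoid (α ⊕ β)) : comp (idDiagram α) a = a := by
  refine le_antisymm ?_ ?_
  · have : stack (idDiagram α) a ≤ a.comap (Sum.elim Sum.inl id) := by
      refine stack_le ?_ (fun x y h => h)
      rintro (x | x) (y | y) h <;>
        (have h' : x = y := h; subst h'; exact a.refl' _)
    rintro (x | x) (y | y) h <;> exact this h
  · rintro (x | x) (y | y) h
    · exact Setoid.trans' (stack (idDiagram α) a) (id_stack_rel a x)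
        (Setoid.trans' (stack (idDiagram α) a) (stack_lower (idDiagram α) a h) (Setoid.symm' (stack (idDiagram α) a) (id_stack_rel a y)))
    · exact Setoid.trans' (stack (idDiagram α) a) (id_stack_rel a x) (stack_lower (idDiagram α) a h)
    · exact Setoid.trans' (stack (idDiagram α) a) (stack_lower (idDiagram α) a h) (Setoid.symm' (stack (idDiagram α) a) (id_stack_rel a y))
    · exact stack_lower (idDiagram α) a h

theorem comp_id (a : Setoid (α ⊕ β)) : comp a (idDiagram β) = a := by
  refine le_antisymm ?_ ?_
  · have : stack a (idDiagram β) ≤ a.comap (Sum.elim Sum.inl (Sum.elim Sum.inr Sum.inr)) := by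
      refine stack_le ?_ ?_
      · rintro (x | x) (y | y) h <;> exact h
      · rintro (x | x) (y | y) h <;>
          (have h' : x = y := h; subst h'; exact a.refl' _)
    rintro (x | x) (y | y) h <;> exact this h
  · rintro (x | x) (y | y) h
    · exact stack_upper a (idDiagram β) h
    · exact Setoid.trans' (stack a (idDiagram β)) (stack_upper a (idDiagram β) h) (Setoid.symm' (stack a (idDiagram β)) (stack_id_rel a y))
    · exact Setoid.trans' (stack a (idDiagram β)) (stack_id_rel a x) (stack_upper a (idDiagram β) h)
    · exact Setoid.trans' (stack a (idDiagram β)) (stack_id_rel a x) (Setoid.trans' (stack a (idDiagram β))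
        (stack_upper a (idDiagram β) h) (Setoid.symm' (stack a (idDiagram β)) (stack_id_rel a y)))

theorem internal_id_left (a : Setoid (α ⊕ β)) : internal (idDiagram α) a = 0 :=
  internal_eq_zero _ _ fun j => ⟨Sum.inl j, id_stack_rel a j⟩

theorem internal_id_right (a : Setoid (α ⊕ β)) : internal a (idDiagram β) = 0 :=
  internal_eq_zero _ _ fun j => ⟨Sum.inr j, stack_id_rel a j⟩

end Gluing

/-! ### Planar diagrams -/

section Planar

variable {n : ℕ}

/-- Position of the `n` top points (`Sum.inl`) and `n` bottom points (`Sum.inr`) on the boundary of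
the rectangle, read along the top from left to right, then along the bottom from right to left. -/
def pos : Fin n ⊕ Fin n → ℕ
  | Sum.inl i => i
  | Sum.inr i => 2 * n - 1 - i

/-- A partition of the boundary points can be drawn in the rectangle without crossings: no two
different blocks interleave on the boundary. -/
def IsPlanar (r : Setoid (Fin n ⊕ Fin n)) : Prop :=
  ∀ w x y z, pos w < pos x → pos x < pos y → pos y < pos z → r w y → r x z → r w x

/-- A partition of the boundary points into blocks of size two. -/
def IsMatching (r : Setoid (Fin n ⊕ Fin n)) : Prop :=
  ∀ s ∈ r.classes, s.ncard = 2

/-- The number of through strands: blocks meeting both the top and the bottom. -/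
noncomputable def throughStrands (r : Setoid (Fin n ⊕ Fin n)) : ℕ :=
  {s | s ∈ r.classes ∧ (∃ i, Sum.inl i ∈ s) ∧ ∃ j, Sum.inr j ∈ s}.ncard

/-! Auxiliary facts: these notions are compatible with gluing. -/

theorem pos_injective : Function.Injective (pos : Fin n ⊕ Fin n → ℕ) := by
  rintro (x | x) (y | y) h <;> simp only [pos] at h
  · exact congrArg _ (Fin.ext h)
  · omega
  · omega
  · exact congrArg _ (Fin.ext (by omega))

/-- Order indicator inside one layer. -/
def ordInd (x y : Fin n ⊕ Fin n) : ZMod 2 :=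
  match x, y with
  | Sum.inl i, Sum.inl j => if i < j then 1 else 0
  | Sum.inr i, Sum.inr j => if i < j then 1 else 0
  | _, _ => 0

/-- Order indicator inside one of three layers. -/
def ordInd3 (x y : Fin n ⊕ (Fin n ⊕ Fin n)) : ZMod 2 :=
  match x, y with
  | Sum.inl i, Sum.inl j => if i < j then 1 else 0
  | Sum.inr i, Sum.inr j => ordInd i j
  | _, _ => 0

/-- Indicator of the bottom layer. -/
def botInd : Fin n ⊕ Fin n → ZMod 2
  | Sum.inl _ => 0
  | Sum.inr _ => 1

theorem pos_ind {x y : Fin n ⊕ Fin n} (h : x ≠ y) :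
    (if pos x < pos y then 1 else 0 : ZMod 2) = ordInd x y + botInd y := by
  rcases x with x | x <;> rcases y with y | y
  · simp [pos, ordInd, botInd]
  · have : (x : ℕ) < 2 * n - 1 - y := by omega
    simp [pos, ordInd, botInd, this]
  · have : ¬ (2 * n - 1 - x < (y : ℕ)) := by omega
    simp [pos, ordInd, botInd, this]
  · have hxy : (x : ℕ) ≠ y := fun h' => h (congrArg _ (Fin.ext h'))
    by_cases hlt : x < y
    · have h1 : (x : ℕ) < y := hlt
      have : ¬ (2 * n - 1 - (x : ℕ) < 2 * n - 1 - y) := by omega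
      simp only [pos, ordInd, botInd, this, hlt, if_true, if_false]
      rfl
    · have h1 : ¬ (x : ℕ) < y := hlt
      have : 2 * n - 1 - (x : ℕ) < 2 * n - 1 - y := by omega
      simp [pos, ordInd, botInd, this, hlt]

theorem cross_eq {x x' y y' : Fin n ⊕ Fin n} (h1 : x ≠ y) (h2 : x' ≠ y) (h3 : x ≠ y')
    (h4 : x' ≠ y') :
    ordInd x y + ordInd x' y + ordInd x y' + ordInd x' y' =
      (if pos x < pos y then 1 else 0 : ZMod 2) + (if pos x' < pos y then 1 else 0) +
        (if pos x < pos y' then 1 else 0) + (if pos x' < pos y' then 1 else 0) := by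
  rw [pos_ind h1, pos_ind h2, pos_ind h3, pos_ind h4]
  have h : ∀ a b c d e f : ZMod 2,
      a + b + c + d = (a + e) + (b + e) + (c + f) + (d + f) := by decide
  exact h _ _ _ _ _ _

theorem IsPlanar.even {r : Setoid (Fin n ⊕ Fin n)} (hr : IsPlanar r) {x x' y y' : Fin n ⊕ Fin n}
    (hx : r x x') (hy : r y y') (hxy : ¬ r x y) :
    ordInd x y + ordInd x' y + ordInd x y' + ordInd x' y' = 0 := by
  have hx' := r.symm' hx
  have hy' := r.symm' hy
  have n1 : ¬ r x y' := fun h => hxy (r.trans' h hy')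
  have n2 : ¬ r x' y := fun h => hxy (r.trans' hx h)
  have n3 : ¬ r x' y' := fun h => n1 (r.trans' hx h)
  have ne : ∀ {u v}, ¬ r u v → u ≠ v := fun h e => h (e ▸ r.refl' _)
  have pne : ∀ {u v}, ¬ r u v → pos u ≠ pos v := fun h e => ne h (pos_injective e)
  rw [cross_eq (ne hxy) (ne n2) (ne n1) (ne n3)]
  have m : ∀ {u v}, ¬ r u v → ¬ r v u := fun h h' => h (r.symm' h')
  have a1 : ¬ (pos x < pos y ∧ pos y < pos x' ∧ pos x' < pos y') :=
    fun ⟨p, q, s⟩ => hxy (hr x y x' y' p q s hx hy)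
  have a2 : ¬ (pos x < pos y' ∧ pos y' < pos x' ∧ pos x' < pos y) :=
    fun ⟨p, q, s⟩ => n1 (hr x y' x' y p q s hx hy')
  have a3 : ¬ (pos x' < pos y ∧ pos y < pos x ∧ pos x < pos y') :=
    fun ⟨p, q, s⟩ => n2 (hr x' y x y' p q s hx' hy)
  have a4 : ¬ (pos x' < pos y' ∧ pos y' < pos x ∧ pos x < pos y) :=
    fun ⟨p, q, s⟩ => n3 (hr x' y' x y p q s hx' hy')
  have b1 : ¬ (pos y < pos x ∧ pos x < pos y' ∧ pos y' < pos x') :=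
    fun ⟨p, q, s⟩ => m hxy (hr y x y' x' p q s hy hx)
  have b2 : ¬ (pos y < pos x' ∧ pos x' < pos y' ∧ pos y' < pos x) :=
    fun ⟨p, q, s⟩ => m n2 (hr y x' y' x p q s hy hx')
  have b3 : ¬ (pos y' < pos x ∧ pos x < pos y ∧ pos y < pos x') :=
    fun ⟨p, q, s⟩ => m n1 (hr y' x y x' p q s hy' hx)
  have b4 : ¬ (pos y' < pos x' ∧ pos x' < pos y ∧ pos y < pos x) :=
    fun ⟨p, q, s⟩ => m n3 (hr y' x' y x p q s hy' hx')
  have c1 := pne hxy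
  have c2 := pne n1
  have c3 := pne n2
  have c4 := pne n3
  have e1 : (1 + 1 : ZMod 2) = 0 := rfl
  split_ifs <;> first | rfl | (exfalso; omega)

theorem ordInd3_upper (x y : Fin n ⊕ Fin n) : ordInd3 (upper x) (upper y) = ordInd x y := by
  rcases x with x | x <;> rcases y with y | y <;> rfl

theorem ordInd3_lower (x y : Fin n ⊕ Fin n) : ordInd3 (lower x) (lower y) = ordInd x y := by
  rcases x with x | x <;> rcases y with y | y <;> rfl

theorem ordInd3_outer (x y : Fin n ⊕ Fin n) : ordInd3 (outer x) (outer y) = ordInd x y := by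
  rcases x with x | x <;> rcases y with y | y <;> rfl

theorem exists_potential {a b : Setoid (Fin n ⊕ Fin n)} (ha : IsPlanar a) (hb : IsPlanar b)
    {y y' : Fin n ⊕ (Fin n ⊕ Fin n)} (h : stack a b y y') :
    ∃ F G : Fin n ⊕ (Fin n ⊕ Fin n) → ZMod 2,
      (∀ x x', a x x' → ¬ stack a b (upper x) y → F (upper x) = F (upper x')) ∧
      (∀ x x', b x x' → ¬ stack a b (lower x) y → G (lower x) = G (lower x')) ∧
      (∀ x, F x + G x = ordInd3 x y + ordInd3 x y') ∧
      (∀ i, F (Sum.inr (Sum.inr i)) = 0) ∧ ∀ i, G (Sum.inl i) = 0 := by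
  have two : ∀ u v : ZMod 2, u = v → u + v = 0 := by decide
  have two' : ∀ u v w z : ZMod 2, u + w + v + z = 0 → u + v = w + z := by decide
  let E : Setoid (Fin n ⊕ (Fin n ⊕ Fin n)) :=
    { r := fun y y' => stack a b y y' ∧ ∃ F G : Fin n ⊕ (Fin n ⊕ Fin n) → ZMod 2,
        (∀ x x', a x x' → ¬ stack a b (upper x) y → F (upper x) = F (upper x')) ∧
        (∀ x x', b x x' → ¬ stack a b (lower x) y → G (lower x) = G (lower x')) ∧
        (∀ x, F x + G x = ordInd3 x y + ordInd3 x y') ∧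
        (∀ i, F (Sum.inr (Sum.inr i)) = 0) ∧ ∀ i, G (Sum.inl i) = 0
      iseqv := by
        refine ⟨fun y => ⟨Setoid.refl' _ _, fun _ => 0, fun _ => 0, ?_⟩, ?_, ?_⟩
        · exact ⟨fun _ _ _ _ => rfl, fun _ _ _ _ => rfl, fun x => (two _ _ rfl).symm,
            fun _ => rfl, fun _ => rfl⟩
        · rintro y y' ⟨h, F, G, h1, h2, h3, h4, h5⟩
          refine ⟨Setoid.symm' _ h, F, G, fun x x' hx hn => h1 x x' hx fun hs => hn ?_,
            fun x x' hx hn => h2 x x' hx fun hs => hn ?_, fun x => by rw [h3, add_comm], h4, h5⟩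
          · exact Setoid.trans' _ hs h
          · exact Setoid.trans' _ hs h
        · rintro y y' y'' ⟨h, F, G, h1, h2, h3, h4, h5⟩ ⟨h', F', G', h1', h2', h3', h4', h5'⟩
          refine ⟨Setoid.trans' _ h h', fun x => F x + F' x, fun x => G x + G' x, ?_, ?_, ?_, ?_, ?_⟩
          · intro x x' hx hn
            exact congrArg₂ (· + ·) (h1 x x' hx hn)
              (h1' x x' hx fun hs => hn (Setoid.trans' _ hs (Setoid.symm' _ h)))
          · intro x x' hx hn
            exact congrArg₂ (· + ·) (h2 x x' hx hn)
              (h2' x x' hx fun hs => hn (Setoid.trans' _ hs (Setoid.symm' _ h)))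
          · intro x
            have k : ∀ f g f' g' p q r : ZMod 2, f + g = p + q → f' + g' = q + r →
                f + f' + (g + g') = p + r := by decide
            exact k _ _ _ _ _ _ _ (h3 x) (h3' x)
          · intro i; change F _ + F' _ = 0; rw [h4, h4', add_zero]
          · intro i; change G _ + G' _ = 0; rw [h5, h5', add_zero] }
  suffices hE : stack a b ≤ E from (hE h).2
  refine stack_le (fun u v huv => ?_) (fun u v huv => ?_)
  · refine ⟨stack_upper a b huv, fun x => ordInd3 x (upper u) + ordInd3 x (upper v), fun _ => 0,
      ?_, fun _ _ _ _ => rfl, fun x => add_zero _, ?_, fun _ => rfl⟩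
    · intro x x' hx hn
      simp only [ordInd3_upper]
      exact two' _ _ _ _ (ha.even hx huv fun hs => hn (stack_upper a b hs))
    · intro i
      rcases u with u | u <;> rcases v with v | v <;> rfl
  · refine ⟨stack_lower a b huv, fun _ => 0, fun x => ordInd3 x (lower u) + ordInd3 x (lower v),
      fun _ _ _ _ => rfl, ?_, fun x => zero_add _, fun _ => rfl, ?_⟩
    · intro x x' hx hn
      simp only [ordInd3_lower]
      exact two' _ _ _ _ (hb.even hx huv fun hs => hn (stack_lower a b hs))
    · intro i
      rcases u with u | u <;> rcases v with v | v <;> rfl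

theorem IsPlanar.comp {a b : Setoid (Fin n ⊕ Fin n)} (ha : IsPlanar a) (hb : IsPlanar b) :
    IsPlanar (comp a b) := by
  intro w x y z hwx hxy hyz hwy hxz
  by_contra hn
  obtain ⟨F, G, h1, h2, h3, h4, h5⟩ := exists_potential ha hb (show stack a b _ _ from hxz)
  let P : Fin n ⊕ (Fin n ⊕ Fin n) → ZMod 2 := fun p =>
    match p with
    | Sum.inl i => F (Sum.inl i)
    | Sum.inr (Sum.inl i) => F (Sum.inr (Sum.inl i))
    | Sum.inr (Sum.inr i) => G (Sum.inr (Sum.inr i))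
  have hmid : ∀ i, F (Sum.inr (Sum.inl i)) = G (Sum.inr (Sum.inl i)) := by
    intro i
    have h0 := h3 (Sum.inr (Sum.inl i))
    have k : ∀ f g : ZMod 2, f + g = 0 + 0 → f = g := by decide
    apply k
    rw [h0]
    rcases x with x | x <;> rcases z with z | z <;> rfl
  have hPu : ∀ q : Fin n ⊕ Fin n, P (upper q) = F (upper q) := by
    rintro (q | q) <;> rfl
  have hPl : ∀ q : Fin n ⊕ Fin n, P (lower q) = G (lower q) := by
    rintro (q | q)
    · exact hmid q
    · rfl
  have hPo : ∀ q : Fin n ⊕ Fin n, P (outer q) = ordInd q x + ordInd q z := by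
    intro q
    rw [← ordInd3_outer, ← ordInd3_outer, ← h3]
    rcases q with q | q
    · change F _ = F _ + G (Sum.inl q)
      rw [h5, add_zero]; rfl
    · change G _ = F (Sum.inr (Sum.inr q)) + G _
      rw [h4, zero_add]; rfl
  let E : Setoid (Fin n ⊕ (Fin n ⊕ Fin n)) :=
    { r := fun p p' => stack a b p p' ∧ (¬ stack a b p (outer x) → P p = P p')
      iseqv := by
        refine ⟨fun p => ⟨Setoid.refl' _ _, fun _ => rfl⟩, ?_, ?_⟩
        · rintro p p' ⟨h, h'⟩
          exact ⟨Setoid.symm' _ h, fun hq => (h' fun hs =>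
            hq (Setoid.trans' _ (Setoid.symm' _ h) hs)).symm⟩
        · rintro p p' p'' ⟨h, h'⟩ ⟨k, k'⟩
          exact ⟨Setoid.trans' _ h k, fun hq => (h' hq).trans (k' fun hs =>
            hq (Setoid.trans' _ h hs))⟩ }
  have hE : stack a b ≤ E := by
    refine stack_le (fun u v huv => ⟨stack_upper a b huv, fun hq => ?_⟩)
      (fun u v huv => ⟨stack_lower a b huv, fun hq => ?_⟩)
    · rw [hPu, hPu]; exact h1 u v huv hq
    · rw [hPl, hPl]; exact h2 u v huv hq
  have hfin := (hE (show stack a b _ _ from hwy)).2 hn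
  rw [hPo, hPo] at hfin
  have ne : ∀ {u v : Fin n ⊕ Fin n}, pos u ≠ pos v → u ≠ v := fun h e => h (congrArg pos e)
  have key := cross_eq (x := w) (x' := y) (y := x) (y' := z) (ne (by omega)) (ne (by omega))
    (ne (by omega)) (ne (by omega))
  rw [if_pos hwx, if_neg (by omega), if_pos (by omega), if_pos hyz] at key
  have k : ∀ p q r s : ZMod 2, p + q = r + s → p + r + q + s ≠ 1 + 0 + 1 + 1 := by decide
  exact k _ _ _ _ hfin key

theorem IsMatching.exists_partner {r : Setoid (Fin n ⊕ Fin n)} (hr : IsMatching r) :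
    ∃ σ : Fin n ⊕ Fin n → Fin n ⊕ Fin n, (∀ x, σ x ≠ x) ∧ (∀ x, σ (σ x) = x) ∧
      ∀ x y, r x y ↔ y = x ∨ y = σ x := by
  have h : ∀ x, ∃ y, y ≠ x ∧ ∀ z, r x z ↔ z = x ∨ z = y := by
    intro x
    obtain ⟨u, v, huv, hs⟩ := Set.ncard_eq_two.1 (hr {z | r z x} ⟨x, rfl⟩)
    have hm : ∀ z, r x z ↔ z = u ∨ z = v := by
      intro z
      have : z ∈ ({z | r z x} : Set _) ↔ z = u ∨ z = v := by rw [hs]; rfl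
      exact ⟨fun h => this.1 (r.symm' h), fun h => r.symm' (this.2 h)⟩
    rcases (hm x).1 (r.refl' x) with e | e
    · exact ⟨v, by rw [e]; exact huv.symm, fun z => by rw [hm z, e]⟩
    · exact ⟨u, by rw [e]; exact huv, fun z => by rw [hm z, e, or_comm]⟩
  choose σ h1 h2 using h
  refine ⟨σ, h1, fun x => ?_, h2⟩
  have hx : r x (σ x) := (h2 x _).2 (Or.inr rfl)
  rcases (h2 (σ x) x).1 (r.symm' hx) with e | e
  · exact absurd e.symm (h1 x)
  · exact e.symm

/-- Following a strand through the glued picture: `(p, true)` continues in the upper diagram,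
`(p, false)` in the lower one. -/
inductive Walk (σ τ : Fin n ⊕ Fin n → Fin n ⊕ Fin n) :
    (Fin n ⊕ (Fin n ⊕ Fin n)) × Bool → (Fin n ⊕ (Fin n ⊕ Fin n)) × Bool → Prop
  | up (x : Fin n ⊕ Fin n) : Walk σ τ (upper x, true) (upper (σ x), false)
  | down (x : Fin n ⊕ Fin n) : Walk σ τ (lower x, false) (lower (τ x), true)

/-- The side from which an outer point enters the glued picture. -/
def side : Fin n ⊕ Fin n → Bool
  | Sum.inl _ => true
  | Sum.inr _ => false

theorem Walk.source {σ τ : Fin n ⊕ Fin n → Fin n ⊕ Fin n} {z p}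
    (h : Walk σ τ (outer z, !(side z)) p) : False := by
  generalize hq : ((outer z, !(side z)) : (Fin n ⊕ (Fin n ⊕ Fin n)) × Bool) = q at h
  rcases h with x | x <;> rcases z with z | z <;> rcases x with x | x <;>
    simp [side, upper, lower, outer] at hq

theorem Walk.target {σ τ : Fin n ⊕ Fin n → Fin n ⊕ Fin n} {z : Fin n ⊕ Fin n} {p}
    (h : Walk σ τ p (outer z, side z)) : False := by
  generalize hq : ((outer z, side z) : (Fin n ⊕ (Fin n ⊕ Fin n)) × Bool) = q at h
  rcases h with x | x
  · rcases z with z | z <;> rcases hx : σ x with y | y <;>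
      simp [side, upper, outer, hx] at hq
  · rcases z with z | z <;> rcases hx : τ x with y | y <;>
      simp [side, lower, outer, hx] at hq

theorem Walk.rightUnique (σ τ : Fin n ⊕ Fin n → Fin n ⊕ Fin n) :
    Relator.RightUnique (Walk σ τ) := by
  intro p q q' h h'
  rcases h with x | x
  · generalize hp : ((upper x, true) : (Fin n ⊕ (Fin n ⊕ Fin n)) × Bool) = p at h'
    rcases h' with y | y
    · rw [upper_injective (congrArg Prod.fst hp)]
    · exact absurd (congrArg Prod.snd hp) (by simp)
  · generalize hp : ((lower x, false) : (Fin n ⊕ (Fin n ⊕ Fin n)) × Bool) = p at h'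
    rcases h' with y | y
    · exact absurd (congrArg Prod.snd hp) (by simp)
    · rw [lower_injective (congrArg Prod.fst hp)]

theorem comp_matching_unique {a b : Setoid (Fin n ⊕ Fin n)} (ha : IsMatching a)
    (hb : IsMatching b) {z z₁ z₂ : Fin n ⊕ Fin n} (h₁ : comp a b z z₁) (h₂ : comp a b z z₂)
    (n₁ : z₁ ≠ z) (n₂ : z₂ ≠ z) : z₁ = z₂ := by
  obtain ⟨σ, -, hσ, hσr⟩ := ha.exists_partner
  obtain ⟨τ, -, hτ, hτr⟩ := hb.exists_partner
  let W : Set (Fin n ⊕ (Fin n ⊕ Fin n)) :=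
    {p | ∃ s, Relation.ReflTransGen (Walk σ τ) (outer z, side z) (p, s)}
  have hWu : ∀ x, upper x ∈ W → upper (σ x) ∈ W := by
    rintro x ⟨s, hs⟩
    cases s
    · rcases Relation.ReflTransGen.cases_tail hs with h | ⟨c, hc, hcx⟩
      · exfalso
        rcases z with z | z <;> rcases x with x | x <;> simp [side, upper, outer] at h
      · generalize hq : ((upper x, false) : (Fin n ⊕ (Fin n ⊕ Fin n)) × Bool) = q at hcx
        rcases hcx with x' | x'
        · have := upper_injective (congrArg Prod.fst hq)
          rw [this, hσ]
          exact ⟨_, hc⟩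
        · exact absurd (congrArg Prod.snd hq) (by simp)
    · exact ⟨_, hs.tail (Walk.up x)⟩
  have hWl : ∀ x, lower x ∈ W → lower (τ x) ∈ W := by
    rintro x ⟨s, hs⟩
    cases s
    · exact ⟨_, hs.tail (Walk.down x)⟩
    · rcases Relation.ReflTransGen.cases_tail hs with h | ⟨c, hc, hcx⟩
      · exfalso
        rcases z with z | z <;> rcases x with x | x <;> simp [side, lower, outer] at h
      · generalize hq : ((lower x, true) : (Fin n ⊕ (Fin n ⊕ Fin n)) × Bool) = q at hcx
        rcases hcx with x' | x'
        · exact absurd (congrArg Prod.snd hq) (by simp)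
        · have := lower_injective (congrArg Prod.fst hq)
          rw [this, hτ]
          exact ⟨_, hc⟩
  have hle : stack a b ≤ Setoid.ker (fun p => p ∈ W) := by
    refine stack_le (fun x y h => ?_) (fun x y h => ?_)
    · refine propext ?_
      rcases (hσr x y).1 h with rfl | rfl
      · exact Iff.rfl
      · exact ⟨hWu x, fun h => by simpa [hσ] using hWu _ h⟩
    · refine propext ?_
      rcases (hτr x y).1 h with rfl | rfl
      · exact Iff.rfl
      · exact ⟨hWl x, fun h => by simpa [hτ] using hWl _ h⟩
  have hz : outer z ∈ W := ⟨_, Relation.ReflTransGen.refl⟩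
  have reach : ∀ y, comp a b z y → y ≠ z →
      Relation.ReflTransGen (Walk σ τ) (outer z, side z) (outer y, !(side y)) := by
    intro y hy hne
    have hyW : outer y ∈ W := (iff_of_eq (hle (show stack a b _ _ from hy))).1 hz
    obtain ⟨s, hs⟩ := hyW
    rcases eq_or_ne s (side y) with rfl | hsy
    · exfalso
      rcases Relation.ReflTransGen.cases_tail hs with h | ⟨c, hc, hcx⟩
      · exact hne (outer_injective (congrArg Prod.fst h))
      · exact hcx.target
    · have : s = !(side y) := by cases s <;> cases h : side y <;> simp_all
      exact this ▸ hs
  have fin : ∀ y y', Relation.ReflTransGen (Walk σ τ) (outer y, !(side y)) (outer y', !(side y')) →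
      y = y' := by
    intro y y' h
    rcases Relation.ReflTransGen.cases_head h with h | ⟨c, hc, -⟩
    · exact outer_injective (congrArg Prod.fst h)
    · exact hc.source.elim
  rcases Relation.ReflTransGen.total_of_right_unique (Walk.rightUnique σ τ)
    (reach z₁ h₁ n₁) (reach z₂ h₂ n₂) with h | h
  · exact fin _ _ h
  · exact (fin _ _ h).symm

theorem IsMatching.sum_eq_zero {r : Setoid (Fin n ⊕ Fin n)} (hr : IsMatching r)
    (χ : Fin n ⊕ Fin n → ZMod 2) (hχ : ∀ x y, r x y → χ x = χ y) : ∑ x, χ x = 0 := by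
  obtain ⟨σ, h1, h2, h3⟩ := hr.exists_partner
  have two : ∀ u v : ZMod 2, u = v → u + v = 0 := by decide
  exact Finset.sum_involution (fun x _ => σ x)
    (fun x _ => two _ _ (hχ _ _ ((h3 x _).2 (Or.inr rfl))))
    (fun x _ _ => h1 x) (fun _ _ => Finset.mem_univ _) (fun x _ => h2 x)

theorem comp_matching_exists {a b : Setoid (Fin n ⊕ Fin n)} (ha : IsMatching a)
    (hb : IsMatching b) (z : Fin n ⊕ Fin n) : ∃ y, comp a b z y ∧ y ≠ z := by
  classical
  by_contra hn
  push Not at hn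
  let χ : Fin n ⊕ (Fin n ⊕ Fin n) → ZMod 2 := fun p => if stack a b (outer z) p then 1 else 0
  have hχ : ∀ p q, stack a b p q → χ p = χ q := by
    intro p q h
    have : stack a b (outer z) p ↔ stack a b (outer z) q :=
      ⟨fun h' => Setoid.trans' _ h' h, fun h' => Setoid.trans' _ h' (Setoid.symm' _ h)⟩
    simp only [χ, this]
  have h1 := ha.sum_eq_zero (fun x => χ (upper x)) fun x y h => hχ _ _ (stack_upper a b h)
  have h2 := hb.sum_eq_zero (fun x => χ (lower x)) fun x y h => hχ _ _ (stack_lower a b h)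
  have h3 : ∑ x, χ (outer x) = 1 := by
    rw [Finset.sum_eq_single z]
    · exact if_pos (Setoid.refl' _ _)
    · intro y _ hy
      exact if_neg fun h => hy (hn y h)
    · intro h
      exact absurd (Finset.mem_univ _) h
  rw [Fintype.sum_sum_type] at h1 h2 h3
  have k : ∀ p q r : ZMod 2, p + q = 0 → q + r = 0 → p + r = 1 → False := by decide
  exact k _ _ _ h1 h2 h3

theorem IsMatching.comp {a b : Setoid (Fin n ⊕ Fin n)} (ha : IsMatching a) (hb : IsMatching b) :
    IsMatching (comp a b) := by
  rintro _ ⟨z, rfl⟩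
  obtain ⟨y, hy, hyz⟩ := comp_matching_exists ha hb z
  rw [Set.ncard_eq_two]
  refine ⟨z, y, hyz.symm, Set.ext fun w => ⟨fun hw => ?_, ?_⟩⟩
  · by_cases hwz : w = z
    · exact Or.inl hwz
    · exact Or.inr (comp_matching_unique ha hb (Setoid.symm' _ hw) hy hwz hyz)
  · rintro (rfl | rfl)
    · exact Setoid.refl' (CyclicDiagram.comp a b) w
    · exact Setoid.symm' _ hy

theorem isPlanar_id : IsPlanar (idDiagram (Fin n)) := by
  rintro (w | w) (x | x) (y | y) (z | z) h1 h2 h3 h4 h5 <;> simp only [pos] at h1 h2 h3 <;>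
    (have h4' : w = y := h4
     have h5' : x = z := h5
     subst h4' h5'
     omega)

theorem isMatching_id : IsMatching (idDiagram (Fin n)) := by
  rintro _ ⟨z, rfl⟩
  rw [Set.ncard_eq_two]
  refine ⟨Sum.inl (Sum.elim id id z), Sum.inr (Sum.elim id id z), by simp, Set.ext fun w => ?_⟩
  change Sum.elim id id w = Sum.elim id id z ↔ w = _ ∨ w = _
  rcases w with w | w <;> simp

theorem exists_top_link {a b : Setoid (Fin n ⊕ Fin n)} {i j : Fin n}
    (h : comp a b (Sum.inl i) (Sum.inr j)) :
    ∃ i' u, comp a b (Sum.inl i') (Sum.inl i) ∧ a (Sum.inl i') (Sum.inr u) := by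
  by_contra hn
  push Not at hn
  have hle : stack a b ≤
      Setoid.ker (fun p => ∃ i', p = Sum.inl i' ∧ comp a b (Sum.inl i') (Sum.inl i)) := by
    refine stack_le (fun x y hxy => propext ?_) (fun x y hxy => propext ?_)
    · rcases x with x | x <;> rcases y with y | y
      · have hs : comp a b (Sum.inl x) (Sum.inl y) := stack_upper a b hxy
        constructor
        · rintro ⟨_, h1, h2⟩
          cases Sum.inl_injective h1
          exact ⟨y, rfl, Setoid.trans' _ (Setoid.symm' _ hs) h2⟩
        · rintro ⟨_, h1, h2⟩
          cases Sum.inl_injective h1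
          exact ⟨x, rfl, Setoid.trans' _ hs h2⟩
      · constructor
        · rintro ⟨_, h1, h2⟩
          cases Sum.inl_injective h1
          exact absurd hxy (hn _ _ h2)
        · rintro ⟨_, h1, _⟩
          simp [upper] at h1
      · constructor
        · rintro ⟨_, h1, _⟩
          simp [upper] at h1
        · rintro ⟨_, h1, h2⟩
          cases Sum.inl_injective h1
          exact absurd (Setoid.symm' _ hxy) (hn _ _ h2)
      · simp [upper]
    · simp [lower]
  have := (iff_of_eq (hle (show stack a b _ _ from h))).1 ⟨i, rfl, Setoid.refl' _ _⟩
  obtain ⟨_, h1, _⟩ := this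
  simp [outer] at h1

theorem exists_bot_link {a b : Setoid (Fin n ⊕ Fin n)} {i j : Fin n}
    (h : comp a b (Sum.inl i) (Sum.inr j)) :
    ∃ j' u, comp a b (Sum.inr j') (Sum.inr j) ∧ b (Sum.inl u) (Sum.inr j') := by
  by_contra hn
  push Not at hn
  have hle : stack a b ≤ Setoid.ker
      (fun p => ∃ j', p = Sum.inr (Sum.inr j') ∧ comp a b (Sum.inr j') (Sum.inr j)) := by
    refine stack_le (fun x y hxy => propext ?_) (fun x y hxy => propext ?_)
    · rcases x with x | x <;> rcases y with y | y <;> simp [upper]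
    · rcases x with x | x <;> rcases y with y | y
      · simp [lower]
      · constructor
        · rintro ⟨_, h1, _⟩
          simp [lower] at h1
        · rintro ⟨_, h1, h2⟩
          cases Sum.inr_injective (Sum.inr_injective h1)
          exact absurd hxy (hn _ _ h2)
      · constructor
        · rintro ⟨_, h1, h2⟩
          cases Sum.inr_injective (Sum.inr_injective h1)
          exact absurd (Setoid.symm' _ hxy) (hn _ _ h2)
        · rintro ⟨_, h1, _⟩
          simp [lower] at h1
      · have hs : comp a b (Sum.inr x) (Sum.inr y) := stack_lower a b hxy
        constructor
        · rintro ⟨_, h1, h2⟩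
          cases Sum.inr_injective (Sum.inr_injective h1)
          exact ⟨y, rfl, Setoid.trans' _ (Setoid.symm' _ hs) h2⟩
        · rintro ⟨_, h1, h2⟩
          cases Sum.inr_injective (Sum.inr_injective h1)
          exact ⟨x, rfl, Setoid.trans' _ hs h2⟩
  have := (iff_of_eq (hle (show stack a b _ _ from h))).2 ⟨j, rfl, Setoid.refl' _ _⟩
  obtain ⟨_, h1, _⟩ := this
  simp [outer] at h1

theorem throughStrands_comp_le_left (a b : Setoid (Fin n ⊕ Fin n)) :
    throughStrands (comp a b) ≤ throughStrands a := by
  have h : ∀ s, s ∈ (comp a b).classes ∧ (∃ i, Sum.inl i ∈ s) ∧ (∃ j, Sum.inr j ∈ s) →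
      ∃ t, (t ∈ a.classes ∧ (∃ i, Sum.inl i ∈ t) ∧ ∃ j, Sum.inr j ∈ t) ∧
        ∃ x, s = {y | comp a b y (Sum.inl x)} ∧ t = {y | a y (Sum.inl x)} := by
    rintro _ ⟨⟨z, rfl⟩, ⟨i, hi⟩, ⟨j, hj⟩⟩
    obtain ⟨x, u, hx, hu⟩ := exists_top_link (Setoid.trans' _ hi (Setoid.symm' _ hj))
    have hxz : comp a b (Sum.inl x) z := Setoid.trans' _ hx hi
    exact ⟨{y | a y (Sum.inl x)}, ⟨⟨_, rfl⟩, ⟨x, a.refl' _⟩, ⟨u, a.symm' hu⟩⟩, x,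
      Set.ext fun y => ⟨fun hy => Setoid.trans' _ hy (Setoid.symm' _ hxz),
        fun hy => Setoid.trans' _ hy hxz⟩, rfl⟩
  choose! t ht hst using h
  refine Set.ncard_le_ncard_of_injOn t ht ?_ (Set.toFinite _)
  intro s hs s' hs' he
  obtain ⟨x, h1, h2⟩ := hst s hs
  obtain ⟨x', h1', h2'⟩ := hst s' hs'
  rw [h2, h2'] at he
  have hm : (Sum.inl x : Fin n ⊕ Fin n) ∈ {y | a y (Sum.inl x')} :=
    (congrArg (fun w => (Sum.inl x : Fin n ⊕ Fin n) ∈ w) he).mp (a.refl' _)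
  have hc : comp a b (Sum.inl x) (Sum.inl x') := stack_upper a b hm
  rw [h1, h1']
  exact Set.ext fun y => ⟨fun hy => Setoid.trans' _ hy hc,
    fun hy => Setoid.trans' _ hy (Setoid.symm' _ hc)⟩

theorem throughStrands_comp_le_right (a b : Setoid (Fin n ⊕ Fin n)) :
    throughStrands (comp a b) ≤ throughStrands b := by
  have h : ∀ s, s ∈ (comp a b).classes ∧ (∃ i, Sum.inl i ∈ s) ∧ (∃ j, Sum.inr j ∈ s) →
      ∃ t, (t ∈ b.classes ∧ (∃ i, Sum.inl i ∈ t) ∧ ∃ j, Sum.inr j ∈ t) ∧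
        ∃ x, s = {y | comp a b y (Sum.inr x)} ∧ t = {y | b y (Sum.inr x)} := by
    rintro _ ⟨⟨z, rfl⟩, ⟨i, hi⟩, ⟨j, hj⟩⟩
    obtain ⟨x, u, hx, hu⟩ := exists_bot_link (Setoid.trans' _ hi (Setoid.symm' _ hj))
    have hxz : comp a b (Sum.inr x) z := Setoid.trans' _ hx hj
    exact ⟨{y | b y (Sum.inr x)}, ⟨⟨_, rfl⟩, ⟨u, hu⟩, ⟨x, b.refl' _⟩⟩, x,
      Set.ext fun y => ⟨fun hy => Setoid.trans' _ hy (Setoid.symm' _ hxz),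
        fun hy => Setoid.trans' _ hy hxz⟩, rfl⟩
  choose! t ht hst using h
  refine Set.ncard_le_ncard_of_injOn t ht ?_ (Set.toFinite _)
  intro s hs s' hs' he
  obtain ⟨x, h1, h2⟩ := hst s hs
  obtain ⟨x', h1', h2'⟩ := hst s' hs'
  rw [h2, h2'] at he
  have hm : (Sum.inr x : Fin n ⊕ Fin n) ∈ {y | b y (Sum.inr x')} :=
    (congrArg (fun w => (Sum.inr x : Fin n ⊕ Fin n) ∈ w) he).mp (b.refl' _)
  have hc : comp a b (Sum.inr x) (Sum.inr x') := stack_lower a b hm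
  rw [h1, h1']
  exact Set.ext fun y => ⟨fun hy => Setoid.trans' _ hy hc,
    fun hy => Setoid.trans' _ hy (Setoid.symm' _ hc)⟩

end Planar

/-! ### Cyclic diagram monoids -/

/-- A diagram on `n` strands with internal components counted modulo `m`: a partition of the
`n` top points (`Sum.inl`) and the `n` bottom points (`Sum.inr`), and a residue modulo `m`. -/
@[ext]
structure CyclicPartition (m n : ℕ) where
  /-- the partition of the boundary points -/
  skeleton : Setoid (Fin n ⊕ Fin n)
  /-- the number of internal components modulo `m` -/
  bubbles : ZMod m

/-- Multiplication by concatenation: `(a, i) (b, j) = (ab, i + j + Φ(a, b))`. -/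
noncomputable instance (m n : ℕ) : Monoid (CyclicPartition m n) where
  mul x y := ⟨comp x.skeleton y.skeleton,
    x.bubbles + y.bubbles + (internal x.skeleton y.skeleton : ZMod m)⟩
  one := ⟨idDiagram (Fin n), 0⟩
  mul_assoc x y z := by
    refine CyclicPartition.ext (comp_assoc _ _ _) ?_
    have h := congrArg (Nat.cast : ℕ → ZMod m)
      (internal_assoc x.skeleton y.skeleton z.skeleton)
    push_cast at h
    change x.bubbles + y.bubbles + _ + z.bubbles + _ = x.bubbles + (y.bubbles + z.bubbles + _) + _
    linear_combination h
  one_mul x := by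
    refine CyclicPartition.ext (id_comp _) ?_
    change 0 + x.bubbles + ((internal (idDiagram (Fin n)) x.skeleton : ℕ) : ZMod m) = x.bubbles
    rw [internal_id_left]; simp
  mul_one x := by
    refine CyclicPartition.ext (comp_id _) ?_
    change x.bubbles + 0 + ((internal x.skeleton (idDiagram (Fin n)) : ℕ) : ZMod m) = x.bubbles
    rw [internal_id_right]; simp

/-- The `m`-cyclic planar partition monoid on `n` strands. -/
def planarPartitionMonoid (m n : ℕ) : Submonoid (CyclicPartition m n) where
  carrier := {x | IsPlanar x.skeleton}
  mul_mem' hx hy := IsPlanar.comp hx hy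
  one_mem' := isPlanar_id

/-- The `m`-cyclic Temperley–Lieb monoid on `n` strands: crossingless matchings, that is, planar
partitions into blocks of size two. -/
def temperleyLiebMonoid (m n : ℕ) : Submonoid (CyclicPartition m n) where
  carrier := {x | IsPlanar x.skeleton ∧ IsMatching x.skeleton}
  mul_mem' hx hy := ⟨IsPlanar.comp hx.1 hy.1, IsMatching.comp hx.2 hy.2⟩
  one_mem' := ⟨isPlanar_id, isMatching_id⟩

section Truncation

variable {m n : ℕ}

/-- The submonoid of a diagram monoid consisting of the identity and of all the diagrams with at
most `l` through strands. -/
def atMost (P : Submonoid (CyclicPartition m n)) (l : ℕ) : Submonoid (CyclicPartition m n) where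
  carrier := {x | x ∈ P ∧ (x = 1 ∨ throughStrands x.skeleton ≤ l)}
  mul_mem' := by
    rintro x y ⟨hx, hx'⟩ ⟨hy, hy'⟩
    refine ⟨P.mul_mem hx hy, ?_⟩
    rcases hx' with rfl | hx'
    · rw [one_mul]; exact hy'
    · exact Or.inr ((throughStrands_comp_le_left _ _).trans hx')
  one_mem' := ⟨P.one_mem, Or.inl rfl⟩

/-- The Rees congruence that identifies all diagrams with fewer than `k` through strands. -/
def reesCon (P : Submonoid (CyclicPartition m n)) (k l : ℕ) : Con (atMost P l) where
  r x y := x = y ∨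
    (throughStrands x.1.skeleton < k ∧ throughStrands y.1.skeleton < k)
  iseqv := by
    refine ⟨fun _ => Or.inl rfl, ?_, ?_⟩
    · rintro x y (h | h)
      · exact Or.inl h.symm
      · exact Or.inr h.symm
    · rintro x y z (rfl | h) (rfl | h')
      · exact Or.inl rfl
      · exact Or.inr h'
      · exact Or.inr h
      · exact Or.inr ⟨h.1, h'.2⟩
  mul' := by
    rintro w x y z (rfl | h) (rfl | h')
    · exact Or.inl rfl
    · exact Or.inr ⟨(throughStrands_comp_le_right _ _).trans_lt h'.1,
        (throughStrands_comp_le_right _ _).trans_lt h'.2⟩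
    · exact Or.inr ⟨(throughStrands_comp_le_left _ _).trans_lt h.1,
        (throughStrands_comp_le_left _ _).trans_lt h.2⟩
    · exact Or.inr ⟨(throughStrands_comp_le_left _ _).trans_lt h.1,
        (throughStrands_comp_le_left _ _).trans_lt h.2⟩

/-- The truncation of a diagram monoid to between `k` and `l` through strands: the Rees factor of
the submonoid of diagrams with at most `l` through strands (and the identity) by the ideal of
diagrams with fewer than `k` through strands, which become the zero element. -/
abbrev Truncation (P : Submonoid (CyclicPartition m n)) (k l : ℕ) : Type :=
  (reesCon P k l).Quotient

end Truncation

end CyclicDiagram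

/-! ### Representation gap -/

namespace RepGap

universe u v

variable (K : Type u) [Field K] (S : Type v) [Monoid S]

/-- A representation isomorphic to a finite direct sum of copies of the trivial representations
`1_t` (every element acts by `1`) and `1_b` (units act by `1`, all the other elements by `0`):
it has a basis of vectors each of which spans a copy of `1_t` or of `1_b`. -/
def IsSumOfTrivial {K : Type u} [Field K] {S : Type v} [Monoid S] {V : Type u} [AddCommGroup V]
    [Module K V] (ρ : Representation K S V) : Prop :=
  ∃ (d : ℕ) (b : Module.Basis (Fin d) K V), ∀ i,
    (∀ s, ρ s (b i) = b i) ∨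
      ∀ s, (IsUnit s → ρ s (b i) = b i) ∧ (¬ IsUnit s → ρ s (b i) = 0)

/-- `S` is the trivial group or the two-element monoid `{1, a}` with `a * a = a`. -/
def IsExceptional : Prop :=
  Nonempty (S ≃* Unit) ∨ Nonempty (S ≃* WithZero Unit)

/-- `(S, K)` is `d`-trivial: all representations of dimension at most `d` are sums of trivial
representations. The two exceptional monoids are only `(-1)`-trivial, by convention. -/
def IsTrivialUpTo (d : ℤ) : Prop :=
  (IsExceptional S → d = -1) ∧
    ∀ (V : Type u) [AddCommGroup V] [Module K V] [FiniteDimensional K V]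
      (ρ : Representation K S V), (Module.finrank K V : ℤ) ≤ d → IsSumOfTrivial ρ

/-- The representation gap: the largest `g` such that `(S, K)` is `(g - 1)`-trivial. -/
noncomputable def gap : ℕ∞ :=
  sSup {g : ℕ∞ | ∃ d : ℕ, g = d ∧ IsTrivialUpTo K S ((d : ℤ) - 1)}

end RepGap

/-!
Replace every block of a planar partition by its boundary curves: the diagram `a` on `n` points
becomes a planar matching `fatten a` on `2n` points, each point being doubled into its left and its
right side. Gluing commutes with taking boundaries, and Euler's formula counts the closed curves
that arise from the middle, so `(a, i) ↦ (fatten a, 2 i + #blocks of a - n)` embeds the `m`-cyclic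
planar partition monoid into the `2m`-cyclic Temperley–Lieb monoid and doubles through strands.

The embedding descends to the truncations. There its image contains the zero element, and every
`t ≠ 1` of the Temperley–Lieb truncation is a left multiple of the image of some `s ≠ 1`: if the
diagram of `t` is `fatten a` and `b` is the mirror image of `a`, take for `s` the diagram `b a`,
because `a b a = a`. Hence a representation of the larger monoid that is a sum of trivial ones on
the smaller monoid is a sum of trivial ones.
-/

namespace CyclicDiagram

section Boundary

variable {X : Type*}

/-- Every point `u` of `X` is doubled into `(u, false)`, just before `u`, and `(u, true)`, just
after `u`, in the order of the positions `P`. The relation says that the doubled point `x` comes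
before the point `u`. -/
def Precedes (P : X → ℕ) (x : X × Bool) (u : X) : Prop :=
  2 * P x.1 + x.2.toNat ≤ 2 * P u

@[simp]
theorem precedes_false {P : X → ℕ} {p u : X} : Precedes P (p, false) u ↔ P p ≤ P u := by
  simp [Precedes]

@[simp]
theorem precedes_true {P : X → ℕ} {p u : X} : Precedes P (p, true) u ↔ P p < P u := by
  simp only [Precedes, Bool.toNat_true]
  omega

/-- The partition of the points into the two sides of the chord between the doubled points `x`
and `y`. -/
def chordSides (P : X → ℕ) (x y : X × Bool) : Setoid X where
  r u v := (Precedes P x u ↔ Precedes P y u) ↔ (Precedes P x v ↔ Precedes P y v)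
  iseqv := ⟨fun _ => Iff.rfl, Iff.symm, Iff.trans⟩

theorem chordSides_rel {P : X → ℕ} {x y : X × Bool} {u v : X} :
    chordSides P x y u v ↔
      ((Precedes P x u ↔ Precedes P y u) ↔ (Precedes P x v ↔ Precedes P y v)) :=
  Iff.rfl

/-- The doubled points, two of them being related when the chord between them separates no two
points of `A` in the same block of `r`. -/
def uncrossed (P : X → ℕ) (A : Set X) (r : Setoid X) : Setoid (X × Bool) where
  r x y := ∀ u ∈ A, ∀ v ∈ A, r u v → chordSides P x y u v
  iseqv := by
    refine ⟨fun x u _ v _ _ => ?_, fun {x y} h u hu v hv huv => ?_,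
      fun {x y z} h k u hu v hv huv => ?_⟩
    · simp only [chordSides_rel]
    · have := h u hu v hv huv
      simp only [chordSides_rel] at this ⊢
      tauto
    · have hxy := h u hu v hv huv
      have hyz := k u hu v hv huv
      simp only [chordSides_rel] at hxy hyz ⊢
      tauto

/-- The curves bounding the blocks of `r`: two doubled points are joined when they lie on the same
block and no block of `r`, restricted to `A`, crosses the chord between them. -/
def boundary (P : X → ℕ) (A : Set X) (r : Setoid X) : Setoid (X × Bool) :=
  r.comap Prod.fst ⊓ uncrossed P A r

theorem boundary_rel {P : X → ℕ} {A : Set X} {r : Setoid X} {x y : X × Bool} :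
    boundary P A r x y ↔ r x.1 y.1 ∧ uncrossed P A r x y :=
  Iff.rfl

theorem uncrossed_mono {P : X → ℕ} {A B : Set X} {r : Setoid X} (hBA : B ⊆ A) :
    uncrossed P A r ≤ uncrossed P B r :=
  fun _ _ h u hu v hv => h u (hBA hu) v (hBA hv)

theorem eq_of_boundary {P : X → ℕ} (hP : Function.Injective P) {A : Set X} {r : Setoid X}
    {p q : X} {c : Bool} (hp : p ∈ A) (hq : q ∈ A) (h : boundary P A r (p, c) (q, c)) : p = q := by
  obtain ⟨hpq, hcross⟩ := boundary_rel.1 h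
  have hside := chordSides_rel.1 (hcross p hp q hq hpq)
  apply hP
  cases c <;> simp only [precedes_false, precedes_true] at hside <;> omega

/-- No two blocks interleave, for the order of the positions `P`. -/
def Noncrossing (P : X → ℕ) (r : Setoid X) : Prop :=
  ∀ w x y z, P w < P x → P x < P y → P y < P z → r w y → r x z → r w x

theorem Noncrossing.mem_Ioo_of_rel {P : X → ℕ} (hP : Function.Injective P) {r : Setoid X}
    (hr : Noncrossing P r) {p q u v : X} (hpq : r p q) (hpu : ¬ r p u)
    (hu : P u ∈ Set.Ioo (P p) (P q)) (huv : r u v) : P v ∈ Set.Ioo (P p) (P q) := by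
  have hpv : ¬ r p v := fun h => hpu (r.trans' h (r.symm' huv))
  have hvp : P v ≠ P p := fun h => hpv (hP h ▸ r.refl' v)
  have hvq : P v ≠ P q := fun h => hpv (hP h ▸ hpq)
  by_contra hv
  rw [Set.mem_Ioo] at hu hv
  rcases lt_or_ge (P v) (P p) with hlt | hge
  · exact hpv (r.symm' (hr v p u q hlt hu.1 hu.2 (r.symm' huv) hpq))
  · exact hpu (hr p u q v hu.1 hu.2 (by omega) hpq huv)

theorem boundary_of_forall_notMem_Ioo {P : X → ℕ} (hP : Function.Injective P) {r : Setoid X}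
    (hr : Noncrossing P r) {p q : X} (hpq : r p q) (hlt : P p < P q)
    (hgap : ∀ v, r p v → P v ∉ Set.Ioo (P p) (P q)) :
    boundary P Set.univ r (p, true) (q, false) := by
  refine ⟨hpq, fun u _ v _ huv => ?_⟩
  have key : ∀ {u v}, r u v → P u ∈ Set.Ioo (P p) (P q) → P v ∈ Set.Ioo (P p) (P q) :=
    fun {u v} huv hu => hr.mem_Ioo_of_rel hP hpq (fun h => hgap u h hu) hu huv
  have huv' := key huv
  have hvu' := key (r.symm' huv)
  simp only [Set.mem_Ioo] at huv' hvu'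
  simp only [chordSides_rel, precedes_true, precedes_false]
  omega

theorem boundary_of_forall_mem_Icc {P : X → ℕ} (hP : Function.Injective P) {r : Setoid X}
    (hr : Noncrossing P r) {p q : X} (hpq : r p q)
    (hall : ∀ v, r p v → P v ∈ Set.Icc (P q) (P p)) :
    boundary P Set.univ r (p, true) (q, false) := by
  refine ⟨hpq, fun u _ v _ huv => ?_⟩
  have key : ∀ {u v}, r u v → P u ∈ Set.Icc (P q) (P p) → P v ∈ Set.Icc (P q) (P p) := by
    intro u v huv hu
    by_cases hpu : r p u
    · exact hall v (r.trans' hpu huv)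
    have hup : P u ≠ P p := fun h => hpu (hP h ▸ r.refl' u)
    have huq : P u ≠ P q := fun h => hpu (hP h ▸ hpq)
    exact Set.Ioo_subset_Icc_self <| hr.mem_Ioo_of_rel hP (r.symm' hpq)
      (fun h => hpu (r.trans' hpq h)) ⟨hu.1.lt_of_ne' huq, hu.2.lt_of_ne hup⟩ huv
  have huv' := key huv
  have hvu' := key (r.symm' huv)
  simp only [Set.mem_Icc] at huv' hvu'
  have hqp := (hall p (r.refl' p)).1
  simp only [chordSides_rel, precedes_true, precedes_false]
  omega

theorem exists_boundary_true_false [Finite X] {P : X → ℕ} (hP : Function.Injective P)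
    {r : Setoid X} (hr : Noncrossing P r) (p : X) :
    ∃ q, boundary P Set.univ r (p, true) (q, false) := by
  by_cases hnext : {v | r p v ∧ P p < P v}.Nonempty
  · obtain ⟨q, ⟨hpq, hlt⟩, hmin⟩ := Set.exists_min_image _ P (Set.toFinite _) hnext
    exact ⟨q, boundary_of_forall_notMem_Ioo hP hr hpq hlt fun v hv hIoo =>
      hIoo.2.not_ge (hmin v ⟨hv, hIoo.1⟩)⟩
  · obtain ⟨q, hpq, hmin⟩ := Set.exists_min_image {v | r p v} P (Set.toFinite _) ⟨p, r.refl' p⟩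
    exact ⟨q, boundary_of_forall_mem_Icc hP hr hpq fun v hv =>
      ⟨hmin v hv, not_lt.1 fun hlt => hnext ⟨v, hv, hlt⟩⟩⟩

theorem exists_boundary_ne [Finite X] {P : X → ℕ} (hP : Function.Injective P) {r : Setoid X}
    (hr : Noncrossing P r) (x : X × Bool) : ∃ y, y ≠ x ∧ boundary P Set.univ r x y := by
  choose next hnext using exists_boundary_true_false hP hr
  have hinj : Function.Injective next := fun p q h =>
    eq_of_boundary hP (Set.mem_univ p) (Set.mem_univ q)
      (Setoid.trans' _ (hnext p) (h ▸ Setoid.symm' _ (hnext q)))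
  rcases x with ⟨p, _ | _⟩
  · obtain ⟨q, rfl⟩ := Finite.injective_iff_surjective.1 hinj p
    exact ⟨(q, true), by simp, Setoid.symm' _ (hnext q)⟩
  · exact ⟨(next p, false), by simp, hnext p⟩

end Boundary

/-! ### Counting blocks -/

section Blocks

variable {X Y : Type*}

/-- The block of `x`. -/
def block (r : Setoid X) (x : X) : Set X :=
  {y | r y x}

theorem block_eq_block {r : Setoid X} {x y : X} : block r x = block r y ↔ r x y := by
  refine ⟨fun h => ?_, fun h => Set.ext fun z =>
    ⟨fun hz => r.trans' hz h, fun hz => r.trans' hz (r.symm' h)⟩⟩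
  exact (h ▸ r.refl' x : x ∈ block r y)

/-- The number of blocks of `r` that meet `A`. -/
noncomputable def numBlocks (r : Setoid X) (A : Set X) : ℕ :=
  (block r '' A).ncard

theorem ncard_image_eq_card_quotient {Z : Type*} (f : Y → Z) (A : Set Y) :
    (f '' A).ncard = Nat.card (Quotient (Setoid.ker fun a : A => f a)) := by
  rw [← Nat.card_coe_set_eq, Nat.card_congr (Setoid.quotientKerEquivRange fun a : A => f a),
    Set.image_eq_range]

theorem numBlocks_image {r : Setoid X} {s : Setoid Y} {A : Set Y} (f : Y → X)
    (h : ∀ u ∈ A, ∀ v ∈ A, s u v ↔ r (f u) (f v)) : numBlocks r (f '' A) = numBlocks s A := by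
  have hker : (Setoid.ker fun a : A => block r (f a)) = Setoid.ker fun a : A => block s a := by
    ext u v
    rw [Setoid.ker_def, Setoid.ker_def, block_eq_block, block_eq_block, h u u.2 v v.2]
  rw [numBlocks, numBlocks, Set.image_image, ncard_image_eq_card_quotient,
    ncard_image_eq_card_quotient, hker]

open Classical in
theorem numBlocks_eq_add_ite [Finite X] {r : Setoid X} {A B : Set X} {p : X} (hp : p ∈ A)
    (hBA : B ⊆ A) (h : ∀ u ∈ A, u ∉ B → r u p) :
    numBlocks r A = numBlocks r B + if ∃ u ∈ B, r u p then 0 else 1 := by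
  have himage : block r '' A = insert (block r p) (block r '' B) := by
    refine Set.Subset.antisymm ?_
      (Set.insert_subset (Set.mem_image_of_mem _ hp) (Set.image_mono hBA))
    rintro _ ⟨u, hu, rfl⟩
    by_cases huB : u ∈ B
    · exact Or.inr (Set.mem_image_of_mem _ huB)
    · exact Or.inl (block_eq_block.2 (h u hu huB))
  have hmem : block r p ∈ block r '' B ↔ ∃ u ∈ B, r u p :=
    exists_congr fun u => and_congr_right fun _ => block_eq_block
  rw [numBlocks, numBlocks, himage]
  split_ifs with hex
  · rw [Set.insert_eq_of_mem (hmem.2 hex), add_zero]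
  · rw [Set.ncard_insert_of_notMem (mt hmem.1 hex) (Set.toFinite _)]

end Blocks

/-! ### Joining two blocks -/

section AddPair

variable {X : Type*}

/-- The partition obtained from `r` by joining the blocks of `p` and `q`. -/
def addPair (r : Setoid X) (p q : X) : Setoid X where
  r x y := r x y ∨ (r x p ∧ r q y) ∨ (r x q ∧ r p y)
  iseqv := by
    refine ⟨fun x => Or.inl (r.refl' x), ?_, ?_⟩
    · rintro x y (h | ⟨h, h'⟩ | ⟨h, h'⟩)
      · exact Or.inl (r.symm' h)
      · exact Or.inr (Or.inr ⟨r.symm' h', r.symm' h⟩)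
      · exact Or.inr (Or.inl ⟨r.symm' h', r.symm' h⟩)
    · rintro x y z (h | ⟨h, h'⟩ | ⟨h, h'⟩) (k | ⟨k, k'⟩ | ⟨k, k'⟩)
      · exact Or.inl (r.trans' h k)
      · exact Or.inr (Or.inl ⟨r.trans' h k, k'⟩)
      · exact Or.inr (Or.inr ⟨r.trans' h k, k'⟩)
      · exact Or.inr (Or.inl ⟨h, r.trans' h' k⟩)
      · exact Or.inr (Or.inl ⟨h, k'⟩)
      · exact Or.inl (r.trans' h k')
      · exact Or.inr (Or.inr ⟨h, r.trans' h' k⟩)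
      · exact Or.inl (r.trans' h k')
      · exact Or.inr (Or.inr ⟨h, k'⟩)

variable {r : Setoid X} {p q : X}

theorem le_addPair : r ≤ addPair r p q :=
  fun _ _ h => Or.inl h

theorem addPair_rel : addPair r p q p q :=
  Or.inr (Or.inl ⟨r.refl' p, r.refl' q⟩)

theorem rel_of_addPair {s : Setoid X} {F : Set X} (hp : p ∈ F) (hq : q ∈ F)
    (hrs : ∀ x ∈ F, ∀ y ∈ F, r x y → s x y) (hpq : s p q) {x y : X} (hx : x ∈ F) (hy : y ∈ F)
    (h : addPair r p q x y) : s x y := by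
  rcases h with h | ⟨h, h'⟩ | ⟨h, h'⟩
  · exact hrs x hx y hy h
  · exact s.trans' (hrs x hx p hp h) (s.trans' hpq (hrs q hq y hy h'))
  · exact s.trans' (hrs x hx q hq h) (s.trans' (s.symm' hpq) (hrs p hp y hy h'))

theorem addPair_le_iff {s : Setoid X} : addPair r p q ≤ s ↔ r ≤ s ∧ s p q :=
  ⟨fun h => ⟨le_addPair.trans h, h addPair_rel⟩, fun h _ _ =>
    rel_of_addPair (F := Set.univ) trivial trivial (fun _ _ _ _ k => h.1 k) h.2 trivial trivial⟩

theorem addPair_eq_self (h : r p q) : addPair r p q = r :=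
  le_antisymm (addPair_le_iff.2 ⟨le_rfl, h⟩) le_addPair

theorem addPair_rel_iff_of_not_rel {x y : X} (hx : ¬ r x q) (hy : ¬ r y q) :
    addPair r p q x y ↔ r x y := by
  refine ⟨?_, fun h => Or.inl h⟩
  rintro (h | ⟨-, h⟩ | ⟨h, -⟩)
  · exact h
  · exact absurd (r.symm' h) hy
  · exact absurd h hx

open Classical in
theorem numBlocks_addPair [Finite X] {A : Set X} (hp : p ∈ A) (hq : q ∈ A) :
    numBlocks (addPair r p q) A + (if r p q then 0 else 1) = numBlocks r A := by
  split_ifs with h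
  · rw [addPair_eq_self h, add_zero]
  let B := {u ∈ A | ¬ r u q}
  have hB : ∀ u ∈ A, u ∉ B → r u q := fun u hu huB => not_not.1 fun hn => huB ⟨hu, hn⟩
  have hr := numBlocks_eq_add_ite hq (Set.sep_subset A _) hB
  have hr' := numBlocks_eq_add_ite (r := addPair r p q) hq (Set.sep_subset A _)
    fun u hu huB => le_addPair (hB u hu huB)
  rw [if_neg fun ⟨u, hu, huq⟩ => hu.2 huq] at hr
  rw [if_pos ⟨p, ⟨hp, h⟩, addPair_rel⟩, add_zero] at hr'
  have hBB : numBlocks (addPair r p q) (id '' B) = numBlocks r B :=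
    numBlocks_image id fun u hu v hv => (addPair_rel_iff_of_not_rel hu.2 hv.2).symm
  rw [Set.image_id] at hBB
  rw [hr, hr', hBB]

theorem exists_addPair_partner {F : Set X}
    (exists_partner : ∀ x ∈ F, ∃ y ∈ F, y ≠ x ∧ r x y)
    (partner_unique : ∀ x ∈ F, ∀ y ∈ F, ∀ z ∈ F, y ≠ x → z ≠ x → r x y → r x z → y = z)
    (hp : p ∈ F) (hq : q ∈ F) (hpq : p ≠ q) :
    ∀ x ∈ F \ {p, q}, ∃ y ∈ F \ {p, q}, y ≠ x ∧ addPair r p q x y := by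
  have mem_iff : ∀ {x}, x ∈ F \ {p, q} ↔ x ∈ F ∧ x ≠ p ∧ x ≠ q := by simp
  intro x hxF
  obtain ⟨hx, hxp, hxq⟩ := mem_iff.1 hxF
  obtain ⟨y, hy, hyx, hxy⟩ := exists_partner x hx
  by_cases hyp : y = p
  · subst hyp
    obtain ⟨z, hz, hzq, hqz⟩ := exists_partner q hq
    refine ⟨z, mem_iff.2 ⟨hz, ?_, hzq⟩, ?_, Or.inr (Or.inl ⟨hxy, hqz⟩)⟩
    · rintro rfl
      exact hxq (partner_unique z hz x hx q hq hyx.symm hpq.symm (r.symm' hxy) (r.symm' hqz))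
    · rintro rfl
      exact hpq (partner_unique z hx y hy q hq hyx hxq.symm hxy (r.symm' hqz))
  by_cases hyq : y = q
  · subst hyq
    obtain ⟨z, hz, hzp, hpz⟩ := exists_partner p hp
    refine ⟨z, mem_iff.2 ⟨hz, hzp, ?_⟩, ?_, Or.inr (Or.inr ⟨hxy, hpz⟩)⟩
    · rintro rfl
      exact hxp (partner_unique z hz x hx p hp hyx.symm hpq (r.symm' hxy) (r.symm' hpz))
    · rintro rfl
      exact hpq (partner_unique z hx p hp y hy hxp.symm hyx (r.symm' hpz) hxy)
  exact ⟨y, mem_iff.2 ⟨hy, hyp, hyq⟩, hyx, Or.inl hxy⟩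

end AddPair

/-! ### Gluing neighbouring points -/

section Contraction

variable {X : Type*} {P : X → ℕ} {A : Set X} {r : Setoid X} {N : Setoid (X × Bool)} {p q : X}

theorem uncrossed_inner (hlt : P p < P q) (hadj : ∀ u ∈ A, P u ∉ Set.Ioo (P p) (P q)) :
    uncrossed P A r (p, true) (q, false) := by
  intro u hu v hv _
  have hpu := hadj u hu
  have hpv := hadj v hv
  rw [Set.mem_Ioo] at hpu hpv
  simp only [chordSides_rel, precedes_true, precedes_false]
  omega

theorem precedes_false_iff_precedes_true (hP : Function.Injective P) (hlt : P p < P q)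
    (hadj : ∀ u ∈ A, P u ∉ Set.Ioo (P p) (P q)) {u : X} (hu : u ∈ A) :
    (Precedes P (p, false) u ↔ Precedes P (q, true) u) ↔ u ∉ ({p, q} : Set X) := by
  have hpu := hadj u hu
  simp only [Set.mem_Ioo, Set.mem_insert_iff, Set.mem_singleton_iff, precedes_true,
    precedes_false, ← hP.eq_iff] at hpu ⊢
  omega

theorem uncrossed_outer (hP : Function.Injective P) (hlt : P p < P q)
    (hadj : ∀ u ∈ A, P u ∉ Set.Ioo (P p) (P q)) :
    uncrossed P (A \ {p, q}) r (p, false) (q, true) := by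
  intro u hu v hv _
  rw [chordSides_rel, precedes_false_iff_precedes_true hP hlt hadj hu.1,
    precedes_false_iff_precedes_true hP hlt hadj hv.1]
  exact iff_of_true hu.2 hv.2

theorem precedes_iff_precedes_of_ne (hP : Function.Injective P) (hlt : P p < P q)
    (hadj : ∀ u ∈ A, P u ∉ Set.Ioo (P p) (P q)) {x : X × Bool} (hx : x.1 ∈ A)
    (hxp : x ≠ (p, true)) (hxq : x ≠ (q, false)) : Precedes P x p ↔ Precedes P x q := by
  have hxpq := hadj x.1 hx
  rcases x with ⟨x, _ | _⟩ <;>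
    simp only [ne_eq, Prod.mk.injEq, and_true, ← hP.eq_iff] at hxp hxq <;>
    simp only [Set.mem_Ioo, precedes_true, precedes_false] at hxpq ⊢ <;> omega

theorem uncrossed_addPair {x y : X × Bool} (hp : p ∈ A) (hq : q ∈ A)
    (hxy : uncrossed P A r x y) (hpq : chordSides P x y p q) :
    uncrossed P A (addPair r p q) x y :=
  fun _ hu _ hv => rel_of_addPair hp hq hxy hpq hu hv

/-- On the doubled points of `F`, the partition `N` into pairs is the boundary of `r`. -/
structure IsBoundaryOn (P : X → ℕ) (F : Set (X × Bool)) (A : Set X) (r : Setoid X)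
    (N : Setoid (X × Bool)) : Prop where
  fst_mem : ∀ x ∈ F, x.1 ∈ A
  le_boundary : ∀ x ∈ F, ∀ y ∈ F, N x y → boundary P A r x y
  exists_partner : ∀ x ∈ F, ∃ y ∈ F, y ≠ x ∧ N x y

namespace IsBoundaryOn

variable {F : Set (X × Bool)}

theorem snd_ne (hP : Function.Injective P) (h : IsBoundaryOn P F A r N) {x y : X × Bool}
    (hx : x ∈ F) (hy : y ∈ F) (hxy : boundary P A r x y) (hne : y ≠ x) : y.2 ≠ x.2 := by
  rcases x with ⟨u, c⟩
  rcases y with ⟨v, d⟩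
  rintro rfl
  exact hne (congrArg (·, d)
    (eq_of_boundary hP (h.fst_mem _ hx) (h.fst_mem _ hy) hxy).symm)

theorem boundary_unique (hP : Function.Injective P) (h : IsBoundaryOn P F A r N)
    {x y z : X × Bool} (hx : x ∈ F) (hy : y ∈ F) (hz : z ∈ F) (hyx : y ≠ x) (hzx : z ≠ x)
    (hxy : boundary P A r x y) (hxz : boundary P A r x z) : y = z := by
  by_contra hne
  have hy2 := h.snd_ne hP hx hy hxy hyx
  have hz2 := h.snd_ne hP hx hz hxz hzx
  have hyz2 := h.snd_ne hP hz hy (Setoid.trans' _ (Setoid.symm' _ hxz) hxy) hne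
  exact hyz2 (by rw [Bool.eq_not.2 hy2, Bool.eq_not.2 hz2])

theorem partner_unique (hP : Function.Injective P) (h : IsBoundaryOn P F A r N) :
    ∀ x ∈ F, ∀ y ∈ F, ∀ z ∈ F, y ≠ x → z ≠ x → N x y → N x z → y = z :=
  fun x hx y hy z hz hyx hzx hxy hxz => h.boundary_unique hP hx hy hz hyx hzx
    (h.le_boundary x hx y hy hxy) (h.le_boundary x hx z hz hxz)

theorem rel_iff (hP : Function.Injective P) (h : IsBoundaryOn P F A r N) {x y : X × Bool}
    (hx : x ∈ F) (hy : y ∈ F) : N x y ↔ boundary P A r x y := by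
  refine ⟨h.le_boundary x hx y hy, fun hxy => ?_⟩
  by_cases hne : y = x
  · exact hne ▸ N.refl' x
  obtain ⟨z, hz, hzx, hxz⟩ := h.exists_partner x hx
  rwa [h.boundary_unique hP hx hy hz hne hzx hxy (h.le_boundary x hx z hz hxz)]

theorem addPair_inner (hP : Function.Injective P) (h : IsBoundaryOn P F A r N)
    (hp : (p, true) ∈ F) (hq : (q, false) ∈ F) (hlt : P p < P q)
    (hadj : ∀ u ∈ A, P u ∉ Set.Ioo (P p) (P q)) :
    IsBoundaryOn P (F \ {(p, true), (q, false)}) A (addPair r p q)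
      (addPair N (p, true) (q, false)) where
  fst_mem x hx := h.fst_mem x hx.1
  le_boundary x hx y hy hxy := by
    have hblock : (addPair r p q).comap Prod.fst x y :=
      rel_of_addPair hp hq (fun x hx y hy hxy => le_addPair (h.le_boundary x hx y hy hxy).1)
        addPair_rel hx.1 hy.1 hxy
    have huncrossed : uncrossed P A r x y :=
      rel_of_addPair hp hq (fun x hx y hy hxy => (h.le_boundary x hx y hy hxy).2)
        (uncrossed_inner hlt hadj) hx.1 hy.1 hxy
    have hside : ∀ z ∈ F \ {(p, true), (q, false)}, (Precedes P z p ↔ Precedes P z q) :=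
      fun z hz => precedes_iff_precedes_of_ne hP hlt hadj (h.fst_mem z hz.1)
        (fun e => hz.2 (Or.inl e)) (fun e => hz.2 (Or.inr e))
    exact ⟨hblock, uncrossed_addPair (h.fst_mem _ hp) (h.fst_mem _ hq) huncrossed
      (iff_congr (hside x hx) (hside y hy))⟩
  exists_partner :=
    exists_addPair_partner h.exists_partner (h.partner_unique hP) hp hq (by simp)

theorem addPair_outer (hP : Function.Injective P) (h : IsBoundaryOn P F A r N)
    (hp : (p, false) ∈ F) (hq : (q, true) ∈ F) (hlt : P p < P q) (hpq : r p q)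
    (hadj : ∀ u ∈ A, P u ∉ Set.Ioo (P p) (P q))
    (hF : ∀ x ∈ F \ {(p, false), (q, true)}, x.1 ∉ ({p, q} : Set X)) :
    IsBoundaryOn P (F \ {(p, false), (q, true)}) (A \ {p, q}) r
      (addPair N (p, false) (q, true)) where
  fst_mem x hx := ⟨h.fst_mem x hx.1, hF x hx⟩
  le_boundary x hx y hy hxy :=
    rel_of_addPair (s := boundary P (A \ {p, q}) r) hp hq
      (fun x hx y hy hxy => ⟨(h.le_boundary x hx y hy hxy).1,
        uncrossed_mono Set.sdiff_subset (h.le_boundary x hx y hy hxy).2⟩)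
      ⟨hpq, uncrossed_outer hP hlt hadj⟩ hx.1 hy.1 hxy
  exists_partner :=
    exists_addPair_partner h.exists_partner (h.partner_unique hP) hp hq (by simp)

theorem inner_rel_iff (hP : Function.Injective P) (h : IsBoundaryOn P F A r N)
    (hp : (p, true) ∈ F) (hq : (q, false) ∈ F) (hlt : P p < P q)
    (hadj : ∀ u ∈ A, P u ∉ Set.Ioo (P p) (P q)) : N (p, true) (q, false) ↔ r p q := by
  rw [h.rel_iff hP hp hq]
  exact and_iff_left (uncrossed_inner hlt hadj)

theorem outer_rel_iff (hP : Function.Injective P) (h : IsBoundaryOn P F A r N)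
    (hp : (p, false) ∈ F) (hq : (q, true) ∈ F) (hlt : P p < P q) (hpq : r p q)
    (hadj : ∀ u ∈ A, P u ∉ Set.Ioo (P p) (P q)) :
    N (p, false) (q, true) ↔ ¬ ∃ u ∈ A \ {p, q}, r u p := by
  rw [h.rel_iff hP hp hq]
  constructor
  · rintro ⟨-, huncrossed⟩ ⟨u, ⟨hu, hupq⟩, hup⟩
    have hside := huncrossed u hu p (h.fst_mem _ hp) hup
    rw [chordSides_rel, precedes_false_iff_precedes_true hP hlt hadj hu,
      precedes_false_iff_precedes_true hP hlt hadj (h.fst_mem _ hp)] at hside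
    exact hside.1 hupq (Or.inl rfl)
  · intro hnone
    have hmem : ∀ {u v}, u ∈ A → r v u → v ∈ ({p, q} : Set X) → u ∈ ({p, q} : Set X) := by
      intro u v hu hvu hv
      have hpv : r p v := by
        rcases hv with rfl | rfl
        exacts [r.refl' _, hpq]
      by_contra hu'
      exact hnone ⟨u, ⟨hu, hu'⟩, r.symm' (r.trans' hpv hvu)⟩
    refine ⟨hpq, fun u hu v hv huv => ?_⟩
    rw [chordSides_rel, precedes_false_iff_precedes_true hP hlt hadj hu,
      precedes_false_iff_precedes_true hP hlt hadj hv]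
    exact not_congr ⟨hmem hv huv, hmem hu (r.symm' huv)⟩

end IsBoundaryOn

/-- The doubled points on the two sides of the points of `A`. -/
def sides (A : Set X) : Set (X × Bool) :=
  Prod.fst ⁻¹' A

theorem mem_sides {x : X × Bool} : x ∈ sides A ↔ x.1 ∈ A :=
  Iff.rfl

theorem sides_diff_inner_diff_outer :
    (sides A \ {(p, true), (q, false)}) \ {(p, false), (q, true)} = sides (A \ {p, q}) := by
  ext ⟨x, c⟩
  cases c <;> simp [mem_sides] <;> tauto

/-- The boundary after gluing `p` to `q`: the sides of `p` facing `q` and facing away from `q` are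
joined to the corresponding sides of `q`. -/
def glueBoundary (N : Setoid (X × Bool)) (p q : X) : Setoid (X × Bool) :=
  addPair (addPair N (p, true) (q, false)) (p, false) (q, true)

theorem outer_left_mem (hne : p ≠ q) (hp : p ∈ A) :
    (p, false) ∈ sides A \ {(p, true), (q, false)} :=
  ⟨hp, by simp [hne]⟩

theorem outer_right_mem (hne : p ≠ q) (hq : q ∈ A) :
    (q, true) ∈ sides A \ {(p, true), (q, false)} :=
  ⟨hq, by simp [hne.symm]⟩

theorem IsBoundaryOn.glue (hP : Function.Injective P) (h : IsBoundaryOn P (sides A) A r N)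
    (hp : p ∈ A) (hq : q ∈ A) (hlt : P p < P q) (hadj : ∀ u ∈ A, P u ∉ Set.Ioo (P p) (P q)) :
    IsBoundaryOn P (sides (A \ {p, q})) (A \ {p, q}) (addPair r p q) (glueBoundary N p q) := by
  have hne : p ≠ q := fun e => hlt.ne (congrArg P e)
  rw [← sides_diff_inner_diff_outer]
  refine (h.addPair_inner hP hp hq hlt hadj).addPair_outer hP (outer_left_mem hne hp)
    (outer_right_mem hne hq) hlt addPair_rel hadj fun x hx => ?_
  rw [sides_diff_inner_diff_outer] at hx
  exact hx.2

/-- The number of curves plus the number of blocks that meet `A`, minus twice the number of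
blocks. Gluing two neighbouring points lowers it by one, whether the gluing merges two blocks or
closes up a hole of a block, and whether or not it closes up an outer curve. -/
noncomputable def gluingDefect (A : Set X) (r : Setoid X) (N : Setoid (X × Bool)) : ℤ :=
  numBlocks N Set.univ + numBlocks r A - 2 * numBlocks r Set.univ

theorem IsBoundaryOn.gluingDefect_glue [Finite X] (hP : Function.Injective P)
    (h : IsBoundaryOn P (sides A) A r N) (hp : p ∈ A) (hq : q ∈ A) (hlt : P p < P q)
    (hadj : ∀ u ∈ A, P u ∉ Set.Ioo (P p) (P q)) :
    gluingDefect (A \ {p, q}) (addPair r p q) (glueBoundary N p q) = gluingDefect A r N - 1 := by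
  classical
  have hne : p ≠ q := fun e => hlt.ne (congrArg P e)
  have hinner : N (p, true) (q, false) ↔ r p q := h.inner_rel_iff hP hp hq hlt hadj
  have houter : addPair N (p, true) (q, false) (p, false) (q, true) ↔
      ¬ ∃ u ∈ A \ {p, q}, addPair r p q u p :=
    (h.addPair_inner hP hp hq hlt hadj).outer_rel_iff hP (outer_left_mem hne hp)
      (outer_right_mem hne hq) hlt addPair_rel hadj
  have hcurves := numBlocks_addPair (r := N) (Set.mem_univ (p, true)) (Set.mem_univ (q, false))
  have hcurves' := numBlocks_addPair (r := addPair N (p, true) (q, false))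
    (Set.mem_univ (p, false)) (Set.mem_univ (q, true))
  have hblocks := numBlocks_addPair (r := r) (Set.mem_univ p) (Set.mem_univ q)
  have hblocksA := numBlocks_addPair (r := r) hp hq
  have hremove : numBlocks (addPair r p q) A = numBlocks (addPair r p q) (A \ {p, q}) +
      if ∃ u ∈ A \ {p, q}, addPair r p q u p then 0 else 1 := by
    refine numBlocks_eq_add_ite hp Set.sdiff_subset fun u hu hu' => ?_
    rcases not_not.1 fun hn => hu' ⟨hu, hn⟩ with rfl | rfl
    exacts [Setoid.refl' _ _, Setoid.symm' _ addPair_rel]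
  simp only [hinner, houter] at hcurves hcurves'
  rw [gluingDefect, gluingDefect, glueBoundary]
  split_ifs at * <;> first | contradiction | omega

end Contraction

/-! ### Gluing along a ladder -/

section Ladder

variable {X : Type*} {ι : Type*} {n : ℕ}

/-- The partition obtained from `r` by joining the blocks of `p i` and `q i` for all `i`. -/
def joinAll (r : Setoid X) (p q : ι → X) : Setoid X :=
  r ⊔ Relation.EqvGen.setoid fun x y => ∃ i, p i = x ∧ q i = y

theorem joinAll_le_iff {r s : Setoid X} {p q : ι → X} :
    joinAll r p q ≤ s ↔ r ≤ s ∧ ∀ i, s (p i) (q i) := by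
  refine sup_le_iff.trans (and_congr_right fun _ =>
    ⟨fun h i => h (Relation.EqvGen.rel _ _ ⟨i, rfl, rfl⟩), fun h => Setoid.eqvGen_le ?_⟩)
  rintro _ _ ⟨i, rfl, rfl⟩
  exact h i

theorem joinAll_of_isEmpty [IsEmpty ι] (r : Setoid X) (p q : ι → X) : joinAll r p q = r :=
  eq_of_forall_ge_iff fun s => by simp [joinAll_le_iff]

theorem joinAll_succ (r : Setoid X) (p q : Fin (n + 1) → X) :
    joinAll r p q = addPair (joinAll r (p ∘ Fin.castSucc) (q ∘ Fin.castSucc))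
      (p (Fin.last n)) (q (Fin.last n)) :=
  eq_of_forall_ge_iff fun s => by
    simp only [joinAll_le_iff, addPair_le_iff, Fin.forall_fin_succ', Function.comp_apply, and_assoc]

/-- The curves obtained from `N` by joining, for all `i`, each side of `p i` to the side of `q i`
that it meets when `p i` is glued to `q i` with reversed orientation. -/
def joinSides (N : Setoid (X × Bool)) (p q : ι → X) : Setoid (X × Bool) :=
  joinAll N (fun i : ι × Bool => (p i.1, i.2)) (fun i => (q i.1, !i.2))

theorem joinSides_succ (N : Setoid (X × Bool)) (p q : Fin (n + 1) → X) :
    joinSides N p q = glueBoundary (joinSides N (p ∘ Fin.castSucc) (q ∘ Fin.castSucc))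
      (p (Fin.last n)) (q (Fin.last n)) :=
  eq_of_forall_ge_iff fun s => by
    simp only [joinSides, glueBoundary, joinAll_le_iff, addPair_le_iff, Prod.forall,
      Fin.forall_fin_succ', Bool.forall_bool, Function.comp_apply, Bool.not_true, Bool.not_false]
    tauto

/-- The pairs `p i`, `q i` are nested around one another, each of them enclosing exactly the
previous ones. -/
structure IsLadder (P : X → ℕ) (p q : Fin n → X) : Prop where
  strictAnti : StrictAnti (P ∘ p)
  strictMono : StrictMono (P ∘ q)
  lt : ∀ i, P (p i) < P (q i)
  exists_eq_of_mem_Ioo : ∀ i u, P u ∈ Set.Ioo (P (p i)) (P (q i)) → ∃ j < i, u = p j ∨ u = q j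

/-- The points that are on none of the rungs. -/
def unglued (p q : ι → X) : Set X :=
  (Set.range p ∪ Set.range q)ᶜ

theorem mem_unglued {p q : ι → X} {u : X} : u ∈ unglued p q ↔ ∀ i, u ≠ p i ∧ u ≠ q i := by
  simp [unglued, forall_and, eq_comm]

theorem unglued_of_isEmpty [IsEmpty ι] (p q : ι → X) : unglued p q = Set.univ := by
  rw [unglued, Set.range_eq_empty, Set.range_eq_empty, Set.union_empty, Set.compl_empty]

theorem unglued_succ (p q : Fin (n + 1) → X) :
    unglued p q = unglued (p ∘ Fin.castSucc) (q ∘ Fin.castSucc) \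
      {p (Fin.last n), q (Fin.last n)} := by
  ext u
  simp only [mem_unglued, Fin.forall_fin_succ', Set.mem_sdiff, Set.mem_insert_iff,
    Set.mem_singleton_iff, not_or, Function.comp_apply, ne_eq]

namespace IsLadder

variable {P : X → ℕ}

theorem castSucc {p q : Fin (n + 1) → X} (h : IsLadder P p q) :
    IsLadder P (p ∘ Fin.castSucc) (q ∘ Fin.castSucc) where
  strictAnti := h.strictAnti.comp_strictMono Fin.strictMono_castSucc
  strictMono := h.strictMono.comp Fin.strictMono_castSucc
  lt i := h.lt i.castSucc
  exists_eq_of_mem_Ioo i u hu := by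
    obtain ⟨j, hj, huj⟩ := h.exists_eq_of_mem_Ioo i.castSucc u hu
    exact ⟨j.castLT (hj.trans i.castSucc_lt_last), hj, huj⟩

theorem last_mem_unglued {p q : Fin (n + 1) → X} (h : IsLadder P p q) :
    p (Fin.last n) ∈ unglued (p ∘ Fin.castSucc) (q ∘ Fin.castSucc) ∧
      q (Fin.last n) ∈ unglued (p ∘ Fin.castSucc) (q ∘ Fin.castSucc) := by
  simp only [mem_unglued, ← forall_and]
  intro i
  have hp := h.strictAnti i.castSucc_lt_last
  have hq := h.strictMono i.castSucc_lt_last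
  have hi := h.lt i.castSucc
  simp only [Function.comp_apply] at hp hq ⊢
  refine ⟨⟨fun e => ?_, fun e => ?_⟩, fun e => ?_, fun e => ?_⟩ <;>
    have := congrArg P e <;> omega

theorem notMem_Ioo_last {p q : Fin (n + 1) → X} (h : IsLadder P p q) :
    ∀ u ∈ unglued (p ∘ Fin.castSucc) (q ∘ Fin.castSucc),
      P u ∉ Set.Ioo (P (p (Fin.last n))) (P (q (Fin.last n))) := by
  intro u hu hIoo
  obtain ⟨j, hj, huj⟩ := h.exists_eq_of_mem_Ioo _ u hIoo
  have hu' := mem_unglued.1 hu (j.castLT hj)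
  simp only [Function.comp_apply, Fin.castSucc_castLT] at hu'
  exact huj.elim hu'.1 hu'.2

variable {r : Setoid X} {N : Setoid (X × Bool)}

theorem isBoundaryOn_joinAll (hP : Function.Injective P)
    (hN : IsBoundaryOn P (sides Set.univ) Set.univ r N) {p q : Fin n → X} (h : IsLadder P p q) :
    IsBoundaryOn P (sides (unglued p q)) (unglued p q) (joinAll r p q) (joinSides N p q) := by
  induction n with
  | zero => rwa [unglued_of_isEmpty, joinAll_of_isEmpty, joinSides, joinAll_of_isEmpty]
  | succ n ih =>
    rw [unglued_succ, joinAll_succ, joinSides_succ]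
    exact (ih h.castSucc).glue hP h.last_mem_unglued.1 h.last_mem_unglued.2 (h.lt _)
      h.notMem_Ioo_last

theorem gluingDefect_joinAll [Finite X] (hP : Function.Injective P)
    (hN : IsBoundaryOn P (sides Set.univ) Set.univ r N) {p q : Fin n → X} (h : IsLadder P p q) :
    gluingDefect (unglued p q) (joinAll r p q) (joinSides N p q) =
      gluingDefect Set.univ r N - n := by
  induction n with
  | zero =>
    rw [unglued_of_isEmpty, joinAll_of_isEmpty, joinSides, joinAll_of_isEmpty, Nat.cast_zero,
      sub_zero]
  | succ n ih =>
    rw [unglued_succ, joinAll_succ, joinSides_succ,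
      (h.castSucc.isBoundaryOn_joinAll hP hN).gluingDefect_glue hP h.last_mem_unglued.1
        h.last_mem_unglued.2 (h.lt _) h.notMem_Ioo_last, ih h.castSucc]
    push_cast
    ring

end IsLadder

theorem isBoundaryOn_boundary [Finite X] {P : X → ℕ} (hP : Function.Injective P) {r : Setoid X}
    (hr : Noncrossing P r) :
    IsBoundaryOn P (sides Set.univ) Set.univ r (boundary P Set.univ r) where
  fst_mem _ hx := hx
  le_boundary _ _ _ _ h := h
  exists_partner x _ :=
    let ⟨y, hyx, hxy⟩ := exists_boundary_ne hP hr x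
    ⟨y, Set.mem_univ y.1, hyx, hxy⟩

theorem IsBoundaryOn.numBlocks_sides {P : X → ℕ} (hP : Function.Injective P) {A : Set X}
    {r : Setoid X} {N : Setoid (X × Bool)} (h : IsBoundaryOn P (sides A) A r N) :
    numBlocks N (sides A) = A.ncard := by
  have himage : block N '' sides A = (fun p => block N (p, true)) '' A := by
    refine Set.Subset.antisymm ?_ ?_
    · rintro _ ⟨⟨p, _ | _⟩, hp, rfl⟩
      · obtain ⟨⟨q, c⟩, hq, hne, hpq⟩ := h.exists_partner _ hp
        have hc := h.snd_ne hP hp hq (h.le_boundary _ hp _ hq hpq) hne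
        obtain rfl : c = true := by simpa using hc
        exact ⟨q, hq, (block_eq_block.2 hpq).symm⟩
      · exact ⟨p, hp, rfl⟩
    · rintro _ ⟨p, hp, rfl⟩
      exact ⟨(p, true), hp, rfl⟩
  rw [numBlocks, himage]
  exact Set.InjOn.ncard_image fun p hp q hq hpq =>
    eq_of_boundary hP hp hq (h.le_boundary (p, true) hp (q, true) hq (block_eq_block.1 hpq))

theorem numBlocks_boundary_univ [Finite X] {P : X → ℕ} (hP : Function.Injective P) {r : Setoid X}
    (hr : Noncrossing P r) : numBlocks (boundary P Set.univ r) Set.univ = Nat.card X := by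
  rw [← Set.ncard_univ, ← (isBoundaryOn_boundary hP hr).numBlocks_sides hP]
  rfl

theorem boundary_image {Y : Type*} {P : X → ℕ} {Q : Y → ℕ} {f : Y → X}
    (hPQ : ∀ u v, P (f u) < P (f v) ↔ Q u < Q v) {r : Setoid X} {x y : Y × Bool} :
    boundary P (Set.range f) r (f x.1, x.2) (f y.1, y.2) ↔
      boundary Q Set.univ (r.comap f) x y := by
  have hprec : ∀ (x : Y × Bool) u, Precedes P (f x.1, x.2) (f u) ↔ Precedes Q x u := by
    rintro ⟨x, _ | _⟩ u
    · rw [precedes_false, precedes_false, ← not_lt, hPQ, not_lt]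
    · rw [precedes_true, precedes_true, hPQ]
  have hsides : ∀ u v,
      chordSides P (f x.1, x.2) (f y.1, y.2) (f u) (f v) ↔ chordSides Q x y u v := fun u v => by
    simp only [chordSides_rel, hprec]
  refine and_congr Iff.rfl ⟨fun h u _ v _ huv => (hsides u v).1 (h _ ⟨u, rfl⟩ _ ⟨v, rfl⟩ huv), ?_⟩
  rintro h _ ⟨u, rfl⟩ _ ⟨v, rfl⟩ huv
  exact (hsides u v).2 (h u trivial v trivial huv)

end Ladder

/-! ### Two partitions side by side -/

section SideBySide

variable {X Y : Type*}

/-- Two partitions side by side. -/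
def sideBySide (a : Setoid X) (b : Setoid Y) : Setoid (X ⊕ Y) where
  r := Sum.LiftRel a b
  iseqv := by
    refine ⟨?_, ?_, ?_⟩
    · rintro (x | x)
      exacts [.inl (a.refl' x), .inr (b.refl' x)]
    · rintro _ _ (h | h)
      exacts [.inl (a.symm' h), .inr (b.symm' h)]
    · rintro _ _ _ (h | h) (k | k)
      exacts [.inl (a.trans' h k), .inr (b.trans' h k)]

variable {a : Setoid X} {b : Setoid Y}

@[simp]
theorem sideBySide_inl_inl {x y : X} : sideBySide a b (Sum.inl x) (Sum.inl y) ↔ a x y :=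
  Sum.liftRel_inl_inl

@[simp]
theorem sideBySide_inr_inr {x y : Y} : sideBySide a b (Sum.inr x) (Sum.inr y) ↔ b x y :=
  Sum.liftRel_inr_inr

@[simp]
theorem not_sideBySide_inl_inr {x : X} {y : Y} : ¬ sideBySide a b (Sum.inl x) (Sum.inr y) :=
  Sum.not_liftRel_inl_inr

@[simp]
theorem not_sideBySide_inr_inl {x : Y} {y : X} : ¬ sideBySide a b (Sum.inr x) (Sum.inl y) :=
  Sum.not_liftRel_inr_inl

theorem sideBySide_le_iff {s : Setoid (X ⊕ Y)} :
    sideBySide a b ≤ s ↔ a ≤ s.comap Sum.inl ∧ b ≤ s.comap Sum.inr := by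
  refine ⟨fun h => ⟨fun _ _ k => h (sideBySide_inl_inl.2 k), fun _ _ k =>
    h (sideBySide_inr_inr.2 k)⟩, fun h => ?_⟩
  rintro _ _ (k | k)
  exacts [h.1 k, h.2 k]

theorem numBlocks_sideBySide [Finite X] [Finite Y] (a : Setoid X) (b : Setoid Y) :
    numBlocks (sideBySide a b) Set.univ = numBlocks a Set.univ + numBlocks b Set.univ := by
  rw [← numBlocks_image (r := sideBySide a b) Sum.inl fun _ _ _ _ => sideBySide_inl_inl.symm,
    ← numBlocks_image (r := sideBySide a b) Sum.inr fun _ _ _ _ => sideBySide_inr_inr.symm]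
  rw [numBlocks, numBlocks, numBlocks, ← Set.ncard_union_eq ?_ (Set.toFinite _) (Set.toFinite _),
    ← Set.image_union, Set.image_univ (f := Sum.inl),
    Set.image_univ (f := Sum.inr), Set.range_inl_union_range_inr]
  rw [Set.disjoint_left]
  rintro _ ⟨_, ⟨x, -, rfl⟩, rfl⟩ ⟨_, ⟨y, -, rfl⟩, h⟩
  exact not_sideBySide_inr_inl (block_eq_block.1 h)

end SideBySide

section Identification

theorem numBlocks_comap {X Z : Type*} {T : Setoid Z} {f : X → Z} (hf : Function.Surjective f) :
    numBlocks (T.comap f) Set.univ = numBlocks T Set.univ := by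
  rw [← numBlocks_image (r := T) f fun _ _ _ _ => Iff.rfl, Set.image_univ, hf.range_eq]

theorem joinAll_eq_comap_map {X Z ι : Type} (r : Setoid X) {f : X → Z} {p q : ι → X}
    (hpq : ∀ i, f (p i) = f (q i))
    (hf : ∀ u v, f u = f v → u = v ∨ ∃ i, u = p i ∧ v = q i ∨ u = q i ∧ v = p i) :
    joinAll r p q = (r.map f).comap f := by
  have hker : Setoid.ker f ≤ joinAll r p q := by
    intro u v huv
    have hjoin := (joinAll_le_iff.1 (le_refl (joinAll r p q))).2
    obtain rfl | ⟨i, ⟨rfl, rfl⟩ | ⟨rfl, rfl⟩⟩ := hf u v huv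
    exacts [Setoid.refl' _ u, hjoin i, Setoid.symm' _ (hjoin i)]
  have hmap : (joinAll r p q).map f = r.map f := eq_of_forall_ge_iff fun s => by
    rw [map_le_iff, map_le_iff, joinAll_le_iff, and_iff_left fun i => ?_]
    rw [Setoid.comap_rel, hpq i]
  rw [← hmap, Setoid.comap_map_of_ker_le f _ hker]

end Identification

/-! ### The boundary of a diagram -/

section Concatenation

variable {X Y : Type*} {P : X → ℕ} {Q : Y → ℕ} {N : ℕ}

/-- The positions of the points of two words, the first one being of length `N`, in the word
obtained by writing them one after the other. -/
def concatPos (N : ℕ) (P : X → ℕ) (Q : Y → ℕ) : X ⊕ Y → ℕ :=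
  Sum.elim P fun y => N + Q y

theorem concatPos_injective (hP : Function.Injective P) (hQ : Function.Injective Q)
    (hN : ∀ x, P x < N) : Function.Injective (concatPos N P Q) :=
  hP.sumElim (fun _ _ h => hQ (Nat.add_left_cancel h)) fun x _ =>
    ((hN x).trans_le (Nat.le_add_right _ _)).ne

theorem noncrossing_sideBySide {a : Setoid X} {b : Setoid Y} (hN : ∀ x, P x < N)
    (ha : Noncrossing P a) (hb : Noncrossing Q b) :
    Noncrossing (concatPos N P Q) (sideBySide a b) := by
  rintro (w | w) (x | x) y z hwx hxy hyz (hwy | hwy) (hxz | hxz) <;>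
    simp only [concatPos, Sum.elim_inl, Sum.elim_inr] at hwx hxy hyz
  · exact sideBySide_inl_inl.2 (ha _ _ _ _ hwx hxy hyz hwy hxz)
  · rename_i y _
    exact absurd (hN y) (by omega)
  · exact absurd (hN x) (by omega)
  · exact sideBySide_inr_inr.2 (hb _ _ _ _ (by omega) (by omega) (by omega) hwy hxz)

theorem precedes_inr_inr {x u : Y} {c : Bool} :
    Precedes (concatPos N P Q) (Sum.inr x, c) (Sum.inr u) ↔ Precedes Q (x, c) u := by
  simp only [Precedes, concatPos, Sum.elim_inr]
  omega

theorem precedes_inl_inr (hN : ∀ x, P x < N) {x : X} {u : Y} {c : Bool} :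
    Precedes (concatPos N P Q) (Sum.inl x, c) (Sum.inr u) := by
  have := hN x
  have := c.toNat_le
  simp only [Precedes, concatPos, Sum.elim_inl, Sum.elim_inr]
  omega

theorem not_precedes_inr_inl (hN : ∀ x, P x < N) {x : Y} {u : X} {c : Bool} :
    ¬ Precedes (concatPos N P Q) (Sum.inr x, c) (Sum.inl u) := by
  have := hN u
  simp only [Precedes, concatPos, Sum.elim_inl, Sum.elim_inr]
  omega

theorem boundary_sideBySide_inl {a : Setoid X} {b : Setoid Y} (hN : ∀ x, P x < N) {x y : X}
    {c d : Bool} :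
    boundary (concatPos N P Q) Set.univ (sideBySide a b) (Sum.inl x, c) (Sum.inl y, d) ↔
      boundary P Set.univ a (x, c) (y, d) := by
  refine and_congr sideBySide_inl_inl ⟨fun h u _ v _ huv =>
    h (Sum.inl u) trivial (Sum.inl v) trivial (sideBySide_inl_inl.2 huv), ?_⟩
  rintro h _ - _ - (huv | huv)
  · exact h _ trivial _ trivial huv
  · simp only [chordSides_rel, precedes_inl_inr hN]

theorem boundary_sideBySide_inr {a : Setoid X} {b : Setoid Y} (hN : ∀ x, P x < N) {x y : Y}
    {c d : Bool} :
    boundary (concatPos N P Q) Set.univ (sideBySide a b) (Sum.inr x, c) (Sum.inr y, d) ↔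
      boundary Q Set.univ b (x, c) (y, d) := by
  refine and_congr sideBySide_inr_inr ⟨fun h u _ v _ huv => ?_, ?_⟩
  · simpa only [chordSides_rel, precedes_inr_inr] using
      h (Sum.inr u) trivial (Sum.inr v) trivial (sideBySide_inr_inr.2 huv)
  rintro h _ - _ - (huv | huv)
  · simp only [chordSides_rel, not_precedes_inr_inl hN]
  · simpa only [chordSides_rel, precedes_inr_inr] using h _ trivial _ trivial huv

theorem boundary_sideBySide_le_iff {a : Setoid X} {b : Setoid Y} (hN : ∀ x, P x < N)
    {s : Setoid ((X ⊕ Y) × Bool)} :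
    boundary (concatPos N P Q) Set.univ (sideBySide a b) ≤ s ↔
      boundary P Set.univ a ≤ s.comap (Prod.map Sum.inl id) ∧
        boundary Q Set.univ b ≤ s.comap (Prod.map Sum.inr id) := by
  refine ⟨fun h => ⟨fun _ _ k => h ((boundary_sideBySide_inl hN).2 k), fun _ _ k =>
    h ((boundary_sideBySide_inr hN).2 k)⟩, ?_⟩
  rintro ⟨ha, hb⟩ ⟨x | x, c⟩ ⟨y | y, d⟩ h
  · exact ha ((boundary_sideBySide_inl hN).1 h)
  · exact absurd h.1 not_sideBySide_inl_inr
  · exact absurd h.1 not_sideBySide_inr_inl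
  · exact hb ((boundary_sideBySide_inr hN).1 h)

end Concatenation

section Fatten

variable {n : ℕ}

/-- Every point of a diagram on `n` strands is doubled into two points of a diagram on `2 * n`
strands; `(x, false)` comes before `(x, true)` in the order given by `pos`, so the two copies of a
bottom point are interchanged, as the bottom is read from right to left. -/
def double : (Fin n ⊕ Fin n) × Bool → Fin (2 * n) ⊕ Fin (2 * n)
  | (Sum.inl i, c) => Sum.inl ⟨2 * i + c.toNat, by have := c.toNat_le; omega⟩
  | (Sum.inr i, c) => Sum.inr ⟨2 * i + (!c).toNat, by have := (!c).toNat_le; omega⟩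

theorem pos_lt (x : Fin n ⊕ Fin n) : pos x < 2 * n := by
  rcases x with x | x <;> simp only [pos] <;> omega

theorem pos_double (x : (Fin n ⊕ Fin n) × Bool) : pos (double x) = 2 * pos x.1 + x.2.toNat := by
  rcases x with ⟨x | x, _ | _⟩ <;> simp [double, pos] <;> omega

theorem double_injective : Function.Injective (double (n := n)) := by
  rintro ⟨x, c⟩ ⟨y, d⟩ h
  have hpos : 2 * pos x + c.toNat = 2 * pos y + d.toNat := by
    simpa only [pos_double] using congrArg pos h
  have hc := c.toNat_le
  have hd := d.toNat_le
  obtain rfl := pos_injective (by omega : pos x = pos y)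
  rw [← c.ofNat_toNat, Nat.add_left_cancel hpos, d.ofNat_toNat]

theorem exists_double_eq (j : Fin (2 * n)) :
    ∃ (i : Fin n) (c : Bool), double (Sum.inr i, c) = Sum.inr j ∧
      double (Sum.inl i, !c) = Sum.inl j := by
  obtain ⟨k, hk | hk⟩ := Nat.even_or_odd' (j : ℕ)
  · exact ⟨⟨k, by omega⟩, true, by simp [double, Fin.ext_iff, hk]⟩
  · exact ⟨⟨k, by omega⟩, false, by simp [double, Fin.ext_iff, hk]⟩

theorem double_surjective : Function.Surjective (double (n := n)) := by
  rintro (j | j) <;> obtain ⟨i, c, hr, hl⟩ := exists_double_eq j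
  exacts [⟨_, hl⟩, ⟨_, hr⟩]

/-- The Temperley–Lieb diagram formed by the curves bounding the blocks of a planar partition. -/
def fatten (a : Setoid (Fin n ⊕ Fin n)) : Setoid (Fin (2 * n) ⊕ Fin (2 * n)) :=
  (boundary pos Set.univ a).map double

theorem comap_double_fatten (a : Setoid (Fin n ⊕ Fin n)) :
    (fatten a).comap double = boundary pos Set.univ a :=
  Setoid.comap_map_of_ker_le _ _ fun _ _ h => double_injective h ▸ Setoid.refl' _ _

theorem fatten_double {a : Setoid (Fin n ⊕ Fin n)} {x y : (Fin n ⊕ Fin n) × Bool} :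
    fatten a (double x) (double y) ↔ boundary pos Set.univ a x y := by
  rw [← comap_double_fatten a]
  rfl

theorem numBlocks_fatten {a : Setoid (Fin n ⊕ Fin n)} (ha : IsPlanar a) :
    numBlocks (fatten a) Set.univ = 2 * n := by
  rw [← numBlocks_comap double_surjective, comap_double_fatten,
    numBlocks_boundary_univ pos_injective ha, Nat.card_sum, Nat.card_fin, two_mul]

end Fatten

/-! ### Concatenation of boundaries -/

section Layers

variable {α β γ : Type}

/-- The map from the points of two diagrams to the three layers of points of the glued picture. -/
def layer : (α ⊕ β) ⊕ (β ⊕ γ) → α ⊕ (β ⊕ γ) :=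
  Sum.elim upper lower

theorem layer_surjective : Function.Surjective (layer : (α ⊕ β) ⊕ (β ⊕ γ) → _) := by
  rintro (x | x)
  exacts [⟨Sum.inl (Sum.inl x), rfl⟩, ⟨Sum.inr x, rfl⟩]

/-- The middle point `i`, as a bottom point of the upper diagram. -/
def midUp (i : β) : (α ⊕ β) ⊕ (β ⊕ γ) := Sum.inl (Sum.inr i)

/-- The middle point `i`, as a top point of the lower diagram. -/
def midDown (i : β) : (α ⊕ β) ⊕ (β ⊕ γ) := Sum.inr (Sum.inl i)

theorem eq_or_mid_of_layer_eq {u v : (α ⊕ β) ⊕ (β ⊕ γ)} (h : layer u = layer v) :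
    u = v ∨ ∃ i, u = midUp i ∧ v = midDown i ∨ u = midDown i ∧ v = midUp i := by
  rcases u with (u | u) | (u | u) <;> rcases v with (v | v) | (v | v) <;>
    simp_all [layer, upper, lower, midUp, midDown]

/-- The outer points, among the points of two diagrams. -/
def outerPair : α ⊕ γ → (α ⊕ β) ⊕ (β ⊕ γ) :=
  Sum.map Sum.inl Sum.inr

theorem layer_outerPair (x : α ⊕ γ) : layer (outerPair (β := β) x) = outer x := by
  rcases x with x | x <;> rfl

theorem range_outerPair :
    Set.range (outerPair : α ⊕ γ → (α ⊕ β) ⊕ (β ⊕ γ)) = unglued midUp midDown := by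
  ext ((x | x) | (x | x)) <;> simp [mem_unglued, outerPair, midUp, midDown]

theorem stack_eq_map (a : Setoid (α ⊕ β)) (b : Setoid (β ⊕ γ)) :
    stack a b = (sideBySide a b).map layer :=
  eq_of_forall_ge_iff fun s => by
    rw [stack, sup_le_iff, map_le_iff, map_le_iff, map_le_iff, sideBySide_le_iff]
    rfl

theorem joinAll_sideBySide (a : Setoid (α ⊕ β)) (b : Setoid (β ⊕ γ)) :
    joinAll (sideBySide a b) midUp midDown = (stack a b).comap layer := by
  rw [stack_eq_map]
  exact joinAll_eq_comap_map _ (fun _ => rfl) fun _ _ => eq_or_mid_of_layer_eq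

theorem joinAll_outerPair (a : Setoid (α ⊕ β)) (b : Setoid (β ⊕ γ)) :
    (joinAll (sideBySide a b) midUp midDown).comap outerPair = comp a b := by
  rw [joinAll_sideBySide]
  ext u v
  rw [Setoid.comap_rel, Setoid.comap_rel, layer_outerPair, layer_outerPair]
  rfl

theorem numBlocks_stack [Finite α] [Finite β] [Finite γ] (a : Setoid (α ⊕ β))
    (b : Setoid (β ⊕ γ)) :
    numBlocks (stack a b) Set.univ = internal a b + numBlocks (comp a b) Set.univ := by
  have houter : numBlocks (stack a b) (outer '' Set.univ) = numBlocks (comp a b) Set.univ :=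
    numBlocks_image outer fun _ _ _ _ => Iff.rfl
  rw [← houter, numBlocks, numBlocks, internal,
    ← Set.ncard_union_eq ?_ (Set.toFinite _) (Set.toFinite _)]
  · congr 1
    ext s
    constructor
    · rintro ⟨x, -, rfl⟩
      by_cases hx : ∃ y, stack a b (outer y) x
      · obtain ⟨y, hy⟩ := hx
        exact Or.inr ⟨_, ⟨y, trivial, rfl⟩, block_eq_block.2 hy⟩
      · exact Or.inl ⟨⟨x, rfl⟩, fun y hy => hx ⟨y, hy⟩⟩
    · rintro (⟨⟨x, rfl⟩, -⟩ | ⟨_, ⟨y, -, rfl⟩, rfl⟩)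
      exacts [⟨x, trivial, rfl⟩, ⟨_, trivial, rfl⟩]
  · rw [Set.disjoint_left]
    rintro _ ⟨-, hs⟩ ⟨_, ⟨y, -, rfl⟩, rfl⟩
    exact hs y (Setoid.refl' (stack a b) (outer y))

end Layers

section CompFatten

variable {n : ℕ}

/-- The position of a point in the word formed by the boundary points of two diagrams. -/
def posPair : (Fin n ⊕ Fin n) ⊕ (Fin n ⊕ Fin n) → ℕ :=
  concatPos (2 * n) pos pos

theorem posPair_injective : Function.Injective (posPair (n := n)) :=
  concatPos_injective pos_injective pos_injective pos_lt

theorem posPair_outerPair_lt_iff {u v : Fin n ⊕ Fin n} :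
    posPair (outerPair u) < posPair (outerPair v) ↔ pos u < pos v := by
  rcases u with u | u <;> rcases v with v | v <;>
    simp only [posPair, concatPos, outerPair, Sum.map_inl, Sum.map_inr, Sum.elim_inl,
      Sum.elim_inr, pos] <;> omega

theorem isLadder_mid : IsLadder (posPair (n := n)) midUp midDown where
  strictAnti i j hij := by
    simp only [Function.comp_apply, posPair, concatPos, midUp, Sum.elim_inl, pos]
    omega
  strictMono i j hij := by
    simp only [Function.comp_apply, posPair, concatPos, midDown, Sum.elim_inr, pos]
    omega
  lt i := by
    simp only [posPair, concatPos, midUp, midDown, Sum.elim_inl, Sum.elim_inr, pos]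
    omega
  exists_eq_of_mem_Ioo i u hu := by
    rcases u with (u | u) | (u | u) <;>
      simp only [posPair, concatPos, midUp, midDown, Sum.elim_inl, Sum.elim_inr, pos,
        Set.mem_Ioo] at hu
    · omega
    · exact ⟨u, by omega, Or.inl rfl⟩
    · exact ⟨u, by omega, Or.inr rfl⟩
    · omega

/-- The map from the doubled points of two diagrams to the three layers of doubled points of the
glued picture. -/
def layerDouble (x : ((Fin n ⊕ Fin n) ⊕ (Fin n ⊕ Fin n)) × Bool) :
    Fin (2 * n) ⊕ (Fin (2 * n) ⊕ Fin (2 * n)) :=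
  layer (Sum.map (fun y => double (y, x.2)) (fun y => double (y, x.2)) x.1)

theorem layerDouble_surjective : Function.Surjective (layerDouble (n := n)) := by
  intro z
  obtain ⟨y | y, rfl⟩ := layer_surjective z <;> obtain ⟨⟨x, c⟩, rfl⟩ := double_surjective y
  exacts [⟨(Sum.inl x, c), rfl⟩, ⟨(Sum.inr x, c), rfl⟩]

theorem layerDouble_outerPair (x : (Fin n ⊕ Fin n) × Bool) :
    layerDouble (outerPair x.1, x.2) = outer (double x) := by
  rcases x with ⟨x | x, c⟩ <;> rfl

theorem layerDouble_mid (i : Fin n) (c : Bool) :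
    layerDouble (midUp i, c) = layerDouble (midDown i, !c) := by
  cases c <;> rfl

theorem eq_or_mid_of_layerDouble_eq {u v : ((Fin n ⊕ Fin n) ⊕ (Fin n ⊕ Fin n)) × Bool}
    (h : layerDouble u = layerDouble v) :
    u = v ∨ ∃ i : Fin n × Bool, u = (midUp i.1, i.2) ∧ v = (midDown i.1, !i.2) ∨
      u = (midDown i.1, !i.2) ∧ v = (midUp i.1, i.2) := by
  have hmid : ∀ {x y c d j}, double (x, c) = Sum.inr j → double (y, d) = Sum.inl j →
      ∃ i : Fin n × Bool, (x, c) = (Sum.inr i.1, i.2) ∧ (y, d) = (Sum.inl i.1, !i.2) := by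
    intro x y c d j hx hy
    obtain ⟨i, e, hr, hl⟩ := exists_double_eq j
    exact ⟨(i, e), double_injective (hx.trans hr.symm), double_injective (hy.trans hl.symm)⟩
  obtain ⟨u | u, c⟩ := u <;> obtain ⟨v | v, d⟩ := v <;>
    obtain h | ⟨j, ⟨hu, hv⟩ | ⟨hu, hv⟩⟩ := eq_or_mid_of_layer_eq h <;>
    simp only [Sum.map_inl, Sum.map_inr, midUp, midDown, Sum.inl.injEq, Sum.inr.injEq,
      reduceCtorEq] at *
  · simpa using double_injective h
  · obtain ⟨i, hx, hy⟩ := hmid hu hv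
    exact Or.inr ⟨i, Or.inl (by simp_all)⟩
  · obtain ⟨i, hx, hy⟩ := hmid hv hu
    exact Or.inr ⟨i, Or.inr (by simp_all)⟩
  · simpa using double_injective h

variable {a b : Setoid (Fin n ⊕ Fin n)}

theorem stack_fatten_eq_map (a b : Setoid (Fin n ⊕ Fin n)) :
    stack (fatten a) (fatten b) =
      (boundary posPair Set.univ (sideBySide a b)).map layerDouble :=
  eq_of_forall_ge_iff fun s => by
    rw [stack, sup_le_iff, map_le_iff, map_le_iff, map_le_iff, fatten, fatten, map_le_iff,
      map_le_iff, posPair, boundary_sideBySide_le_iff pos_lt]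
    rfl

theorem joinSides_boundary_sideBySide (a b : Setoid (Fin n ⊕ Fin n)) :
    joinSides (boundary posPair Set.univ (sideBySide a b)) midUp midDown =
      (stack (fatten a) (fatten b)).comap layerDouble := by
  rw [stack_fatten_eq_map]
  exact joinAll_eq_comap_map _ (fun i => layerDouble_mid i.1 i.2) fun _ _ =>
    eq_or_mid_of_layerDouble_eq

theorem isBoundaryOn_posPair (ha : IsPlanar a) (hb : IsPlanar b) :
    IsBoundaryOn posPair (sides Set.univ) Set.univ (sideBySide a b)
      (boundary posPair Set.univ (sideBySide a b)) :=
  isBoundaryOn_boundary posPair_injective (noncrossing_sideBySide pos_lt ha hb)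

theorem comp_fatten (ha : IsPlanar a) (hb : IsPlanar b) :
    comp (fatten a) (fatten b) = fatten (comp a b) := by
  have hglued := isLadder_mid.isBoundaryOn_joinAll posPair_injective (isBoundaryOn_posPair ha hb)
  rw [← range_outerPair] at hglued
  ext x y
  obtain ⟨x, rfl⟩ := double_surjective x
  obtain ⟨y, rfl⟩ := double_surjective y
  calc comp (fatten a) (fatten b) (double x) (double y)
      ↔ joinSides (boundary posPair Set.univ (sideBySide a b)) midUp midDown
          (outerPair x.1, x.2) (outerPair y.1, y.2) := by
        rw [joinSides_boundary_sideBySide]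
        change stack _ _ (outer _) (outer _) ↔ stack _ _ (layerDouble _) (layerDouble _)
        rw [layerDouble_outerPair x, layerDouble_outerPair y]
    _ ↔ boundary posPair (Set.range outerPair) (joinAll (sideBySide a b) midUp midDown)
          (outerPair x.1, x.2) (outerPair y.1, y.2) :=
        hglued.rel_iff posPair_injective (Set.mem_range_self x.1) (Set.mem_range_self y.1)
    _ ↔ boundary pos Set.univ (comp a b) x y := by
        rw [boundary_image (f := outerPair) fun _ _ => posPair_outerPair_lt_iff, joinAll_outerPair]
    _ ↔ fatten (comp a b) (double x) (double y) := fatten_double.symm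

theorem internal_fatten (ha : IsPlanar a) (hb : IsPlanar b) :
    internal (fatten a) (fatten b) + numBlocks a Set.univ + numBlocks b Set.univ =
      n + 2 * internal a b + numBlocks (comp a b) Set.univ := by
  have hdefect :=
    isLadder_mid.gluingDefect_joinAll posPair_injective (isBoundaryOn_posPair ha hb)
  have hcurves : numBlocks (joinSides (boundary posPair Set.univ (sideBySide a b)) midUp midDown)
      Set.univ = internal (fatten a) (fatten b) + 2 * n := by
    rw [joinSides_boundary_sideBySide, numBlocks_comap layerDouble_surjective, numBlocks_stack,
      comp_fatten ha hb, numBlocks_fatten (ha.comp hb)]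
  have houter : numBlocks (joinAll (sideBySide a b) midUp midDown) (unglued midUp midDown) =
      numBlocks (comp a b) Set.univ := by
    rw [← joinAll_outerPair, ← range_outerPair, ← Set.image_univ]
    exact numBlocks_image outerPair fun _ _ _ _ => Iff.rfl
  have hglued : numBlocks (joinAll (sideBySide a b) midUp midDown) Set.univ =
      internal a b + numBlocks (comp a b) Set.univ := by
    rw [joinAll_sideBySide, numBlocks_comap layer_surjective, numBlocks_stack]
  have hcard : numBlocks (boundary posPair Set.univ (sideBySide a b)) Set.univ = 4 * n := by
    rw [numBlocks_boundary_univ posPair_injective (noncrossing_sideBySide pos_lt ha hb)]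
    simp only [Nat.card_sum, Nat.card_fin]
    ring
  rw [gluingDefect, gluingDefect, hcurves, houter, hglued, hcard, numBlocks_sideBySide] at hdefect
  omega

end CompFatten

/-! ### Planar matchings are boundaries -/

section Matching

variable {n : ℕ}

theorem isMatching_iff {r : Setoid (Fin n ⊕ Fin n)} :
    IsMatching r ↔ ∀ x, ∃! y, y ≠ x ∧ r x y := by
  constructor
  · intro hr x
    obtain ⟨σ, hσ, -, hrσ⟩ := hr.exists_partner
    exact ⟨σ x, ⟨hσ x, (hrσ x _).2 (Or.inr rfl)⟩, fun y hy => ((hrσ x y).1 hy.2).resolve_left hy.1⟩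
  · rintro hr _ ⟨x, rfl⟩
    obtain ⟨y, ⟨hyx, hxy⟩, hunique⟩ := hr x
    refine Set.ncard_eq_two.2 ⟨x, y, hyx.symm, Set.ext fun z => ⟨fun hz => ?_, ?_⟩⟩
    · exact or_iff_not_imp_left.2 fun hzx => hunique z ⟨hzx, r.symm' hz⟩
    · rintro (rfl | rfl)
      exacts [r.refl' z, r.symm' hxy]

theorem IsMatching.eq_of_le {r s : Setoid (Fin n ⊕ Fin n)} (hr : IsMatching r)
    (hs : IsMatching s) (h : r ≤ s) : r = s := by
  refine le_antisymm h fun x y hxy => ?_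
  by_cases hyx : y = x
  · exact hyx ▸ r.refl' y
  obtain ⟨z, ⟨hzx, hxz⟩, -⟩ := isMatching_iff.1 hr x
  rwa [(isMatching_iff.1 hs x).unique ⟨hyx, hxy⟩ ⟨hzx, h hxz⟩]

theorem isMatching_fatten {a : Setoid (Fin n ⊕ Fin n)} (ha : IsPlanar a) :
    IsMatching (fatten a) := by
  refine isMatching_iff.2 <| double_surjective.forall.2 fun x => ?_
  obtain ⟨y, hyx, hxy⟩ := exists_boundary_ne pos_injective ha x
  refine ⟨double y, ⟨double_injective.ne hyx, fatten_double.2 hxy⟩,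
    double_surjective.forall.2 fun z ⟨hzx, hxz⟩ => congrArg double ?_⟩
  exact (isBoundaryOn_boundary pos_injective ha).boundary_unique pos_injective
    (Set.mem_univ x.1) (Set.mem_univ z.1) (Set.mem_univ y.1) (fun h => hzx (h ▸ rfl)) hyx
    (fatten_double.1 hxz) hxy

theorem isPlanar_fatten (a : Setoid (Fin n ⊕ Fin n)) : IsPlanar (fatten a) := by
  intro w' x' y' z' hwx hxy hyz hwy hxz
  obtain ⟨w, rfl⟩ := double_surjective w'
  obtain ⟨x, rfl⟩ := double_surjective x'
  obtain ⟨y, rfl⟩ := double_surjective y'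
  obtain ⟨z, rfl⟩ := double_surjective z'
  exfalso
  have hside := (fatten_double.1 hwy).2 x.1 trivial z.1 trivial (fatten_double.1 hxz).1
  simp only [chordSides_rel, Precedes] at hside
  rw [pos_double, pos_double] at hwx hxy hyz
  have := w.2.toNat_le
  have := x.2.toNat_le
  have := y.2.toNat_le
  have := z.2.toNat_le
  omega

end Matching

section Recover

variable {X : Type*} {P : X → ℕ} {r : Setoid X}

theorem lt_and_le_of_boundary {p q v : X} (h : boundary P Set.univ r (p, true) (q, false))
    (hpv : r p v) (hlt : P p < P v) : P p < P q ∧ P q ≤ P v := by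
  have hside := h.2 p trivial v trivial hpv
  simp only [chordSides_rel, precedes_true, precedes_false] at hside
  omega

theorem le_of_forall_boundary (hP : Function.Injective P)
    (exists_next : ∀ p, ∃ q, boundary P Set.univ r (p, true) (q, false)) {s : Setoid X}
    (hs : ∀ p q, boundary P Set.univ r (p, true) (q, false) → s p q) : r ≤ s := by
  have rel_of_lt : ∀ d u v, P v - P u = d → r u v → P u < P v → s u v := by
    intro d
    induction d using Nat.strong_induction_on with
    | _ d ih =>
      intro u v hd huv hlt
      obtain ⟨q, hq⟩ := exists_next u
      obtain ⟨huq, hqv⟩ := lt_and_le_of_boundary hq huv hlt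
      rcases hqv.lt_or_eq with hqv | hqv
      · exact s.trans' (hs _ _ hq)
          (ih (P v - P q) (by omega) q v rfl (r.trans' (r.symm' hq.1) huv) hqv)
      · exact hP hqv ▸ hs _ _ hq
  intro u v huv
  rcases lt_trichotomy (P u) (P v) with h | h | h
  · exact rel_of_lt _ u v rfl huv h
  · exact hP h ▸ s.refl' u
  · exact s.symm' (rel_of_lt _ v u rfl (r.symm' huv) h)

theorem noncrossing_of_exists_boundary [Finite X] (hP : Function.Injective P)
    (exists_next : ∀ p, ∃ q, boundary P Set.univ r (p, true) (q, false)) : Noncrossing P r := by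
  intro w x y z hwx hxy hyz hwy hxz
  by_contra hn
  -- The curve leaving the last point `p` of the block of `w` before `x` separates `x` from `z`.
  obtain ⟨p, ⟨hwp, hpx⟩, hmax⟩ := Set.exists_max_image {u | r w u ∧ P u < P x} P
    (Set.toFinite _) ⟨w, r.refl' w, hwx⟩
  obtain ⟨q, hq⟩ := exists_next p
  obtain ⟨hpq, hqy⟩ := lt_and_le_of_boundary hq (r.trans' (r.symm' hwp) hwy) (hpx.trans hxy)
  have hwq : r w q := r.trans' hwp hq.1
  have hxq : P x < P q := (not_lt.1 fun h => (hmax q ⟨hwq, h⟩).not_gt hpq).lt_of_ne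
    fun h => hn (hP h ▸ hwq)
  have hside := hq.2 x trivial z trivial hxz
  simp only [chordSides_rel, precedes_true, precedes_false] at hside
  omega

theorem Noncrossing.chordSides_of_rel (hP : Function.Injective P) (hr : Noncrossing P r)
    {x y z w : X} {c : Bool} (hxy : r x y) (hzw : r z w) (hxz : ¬ r x z) :
    chordSides P (x, c) (y, c) z w := by
  wlog hle : P x ≤ P y generalizing x y
  · have := this (r.symm' hxy) (fun h => hxz (r.trans' hxy h)) (by omega)
    rw [chordSides_rel] at this ⊢
    tauto
  have ne : ∀ {u v}, r x u → r z v → P u ≠ P v := fun hu hv h =>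
    hxz (r.trans' (hP h ▸ hu) (r.symm' hv))
  have hxz' := ne (r.refl' x) (r.refl' z)
  have hyz' := ne hxy (r.refl' z)
  have hxw' := ne (r.refl' x) hzw
  have hyw' := ne hxy hzw
  have hzw' := hr.mem_Ioo_of_rel hP hxy (v := w) hxz
  have hwz' := hr.mem_Ioo_of_rel hP hxy (u := w) (v := z) fun h => hxz (r.trans' h (r.symm' hzw))
  simp only [Set.mem_Ioo, hzw, r.symm' hzw, forall_const] at hzw' hwz'
  cases c <;> simp only [chordSides_rel, precedes_false, precedes_true] <;> omega

end Recover

section Collapse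

variable {n : ℕ}

theorem fatten_injOn : Set.InjOn (fatten (n := n)) {a | IsPlanar a} := by
  have le_of_eq : ∀ {a b : Setoid (Fin n ⊕ Fin n)}, IsPlanar a → fatten a = fatten b → a ≤ b :=
    fun ha h => le_of_forall_boundary pos_injective (exists_boundary_true_false pos_injective ha)
      fun p q hpq => (fatten_double.1 (h ▸ fatten_double.2 hpq)).1
  exact fun a ha b hb h => le_antisymm (le_of_eq ha h) (le_of_eq hb h.symm)

theorem exists_pos_eq {k : ℕ} (hk : k < 2 * n) : ∃ x : Fin n ⊕ Fin n, pos x = k := by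
  by_cases h : k < n
  · exact ⟨Sum.inl ⟨k, h⟩, rfl⟩
  · exact ⟨Sum.inr ⟨2 * n - 1 - k, by omega⟩, by simp only [pos]; omega⟩

theorem card_filter_pos_mem_Ioo (k : ℕ) (y : Fin n ⊕ Fin n) :
    (Finset.univ.filter fun z : Fin n ⊕ Fin n => pos z ∈ Set.Ioo k (pos y)).card =
      pos y - k - 1 := by
  rw [← Nat.card_Ioo, ← Finset.card_image_of_injective _ pos_injective]
  congr 1
  ext j
  simp only [Finset.mem_image, Finset.mem_filter, Finset.mem_univ, true_and, Set.mem_Ioo,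
    Finset.mem_Ioo]
  refine ⟨?_, fun hj => ?_⟩
  · rintro ⟨z, hz, rfl⟩
    exact hz
  · obtain ⟨z, rfl⟩ := exists_pos_eq (n := n) (hj.2.trans (pos_lt y))
    exact ⟨z, hj, rfl⟩

theorem IsMatching.odd_pos_add_pos {r : Setoid (Fin n ⊕ Fin n)} (hm : IsMatching r)
    (hr : IsPlanar r) {x y : Fin n ⊕ Fin n} (hxy : r x y) (hne : x ≠ y) :
    Odd (pos x + pos y) := by
  wlog hlt : pos x < pos y generalizing x y
  · rw [add_comm]
    exact this (r.symm' hxy) hne.symm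
      ((not_lt.1 hlt).lt_of_ne fun h => hne (pos_injective h).symm)
  have mem_Ioo_of_rel : ∀ z w, r z w → pos z ∈ Set.Ioo (pos x) (pos y) →
      pos w ∈ Set.Ioo (pos x) (pos y) := by
    refine fun z w hzw hz =>
      Noncrossing.mem_Ioo_of_rel pos_injective hr hxy (fun hxz => ?_) hz hzw
    have hzx : z ≠ x := fun h => (h ▸ hz.1).false
    exact ((isMatching_iff.1 hm x).unique ⟨hzx, hxz⟩ ⟨hne.symm, hxy⟩ ▸ hz.2).false
  -- The points strictly between `x` and `y` are matched among themselves.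
  have hsum := hm.sum_eq_zero (fun z => if pos z ∈ Set.Ioo (pos x) (pos y) then 1 else 0)
    fun z w hzw =>
      if_congr ⟨mem_Ioo_of_rel z w hzw, mem_Ioo_of_rel w z (r.symm' hzw)⟩ rfl rfl
  rw [Finset.sum_boole, card_filter_pos_mem_Ioo, ZMod.natCast_eq_zero_iff] at hsum
  rw [Nat.odd_iff]
  omega

/-- The partition whose blocks are obtained from a matching of the doubled points by identifying
the two copies of every point; it inverts `fatten` on planar matchings. -/
def collapse (s : Setoid (Fin (2 * n) ⊕ Fin (2 * n))) : Setoid (Fin n ⊕ Fin n) :=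
  (s.comap double).map Prod.fst

theorem precedes_iff_pos_double_lt {x z : (Fin n ⊕ Fin n) × Bool} (h : x ≠ z) :
    Precedes pos x z.1 ↔ pos (double x) < pos (double z) := by
  have hne : pos (double x) ≠ pos (double z) := (pos_injective.comp double_injective).ne h
  have := z.2.toNat_le
  rw [pos_double, pos_double] at hne ⊢
  rw [Precedes]
  omega

theorem chordSides_self {x y : (Fin n ⊕ Fin n) × Bool}
    (h : Odd (pos (double x) + pos (double y))) : chordSides pos x y x.1 y.1 := by
  rw [pos_double, pos_double, Nat.odd_iff] at h
  have := x.2.toNat_le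
  have := y.2.toNat_le
  simp only [chordSides_rel, Precedes]
  omega

variable {s : Setoid (Fin (2 * n) ⊕ Fin (2 * n))}

theorem collapse_le_chordSides (hs : IsPlanar s) (hm : IsMatching s)
    {x y : (Fin n ⊕ Fin n) × Bool} (hxy : s (double x) (double y)) :
    collapse s ≤ chordSides pos x y := by
  refine map_le_iff.2 fun z w hzw => ?_
  replace hzw : s (double z) (double w) := hzw
  change chordSides pos x y z.1 w.1
  rcases eq_or_ne x y with rfl | hne
  · simp only [chordSides_rel]
  rcases eq_or_ne z w with rfl | hzw_ne
  · exact Setoid.refl' _ _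
  have hne' := double_injective.ne hne
  have hzw_ne' := double_injective.ne hzw_ne
  by_cases hxz : s (double x) (double z)
  · have hside := chordSides_self (hm.odd_pos_add_pos hs hxy hne')
    rcases eq_or_ne z x with rfl | hzx
    · obtain rfl := double_injective <|
        (isMatching_iff.1 hm _).unique ⟨hzw_ne'.symm, hzw⟩ ⟨hne'.symm, hxy⟩
      exact hside
    · obtain rfl := double_injective <|
        (isMatching_iff.1 hm _).unique ⟨double_injective.ne hzx, hxz⟩ ⟨hne'.symm, hxy⟩
      obtain rfl := double_injective <|
        (isMatching_iff.1 hm _).unique ⟨hzw_ne'.symm, hzw⟩ ⟨hne', s.symm' hxy⟩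
      exact Setoid.symm' _ hside
  · have hside := Noncrossing.chordSides_of_rel (c := true) pos_injective hs hxy hzw hxz
    have ne : ∀ {u v}, s (double x) (double u) → s (double z) (double v) → u ≠ v := by
      rintro u _ hu hv rfl
      exact hxz (s.trans' hu (s.symm' hv))
    rw [chordSides_rel, precedes_iff_pos_double_lt (ne (s.refl' _) (s.refl' _)),
      precedes_iff_pos_double_lt (ne hxy (s.refl' _)),
      precedes_iff_pos_double_lt (ne (s.refl' _) hzw), precedes_iff_pos_double_lt (ne hxy hzw)]
    simpa only [chordSides_rel, precedes_true] using hside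

theorem comap_double_le_boundary_collapse (hs : IsPlanar s) (hm : IsMatching s) :
    s.comap double ≤ boundary pos Set.univ (collapse s) := fun x y hxy =>
  ⟨Relation.EqvGen.rel _ _ ⟨x, y, hxy, rfl, rfl⟩,
    fun _ _ _ _ huv => collapse_le_chordSides hs hm hxy huv⟩

theorem isPlanar_collapse (hs : IsPlanar s) (hm : IsMatching s) : IsPlanar (collapse s) := by
  refine noncrossing_of_exists_boundary pos_injective fun p => ?_
  obtain ⟨y, ⟨hne, hpy⟩, -⟩ := isMatching_iff.1 hm (double (p, true))
  obtain ⟨⟨q, c⟩, rfl⟩ := double_surjective y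
  have hpq := comap_double_le_boundary_collapse hs hm hpy
  cases c with
  | false => exact ⟨q, hpq⟩
  | true =>
    have hpq' : p = q := eq_of_boundary pos_injective (Set.mem_univ p) (Set.mem_univ q) hpq
    exact absurd (hpq' ▸ rfl) hne

theorem fatten_collapse (hs : IsPlanar s) (hm : IsMatching s) : fatten (collapse s) = s := by
  refine (hm.eq_of_le (isMatching_fatten (isPlanar_collapse hs hm)) ?_).symm
  intro x' y' hxy
  obtain ⟨x, rfl⟩ := double_surjective x'
  obtain ⟨y, rfl⟩ := double_surjective y'
  exact fatten_double.2 (comap_double_le_boundary_collapse hs hm hxy)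

end Collapse

/-! ### Through strands -/

section Straddling

variable {X : Type*}

/-- The points whose block meets both `T` and its complement. -/
def straddling (r : Setoid X) (T : Set X) : Set X :=
  {x | (∃ p ∈ T, r p x) ∧ ∃ q ∉ T, r q x}

theorem straddling_compl (r : Setoid X) (T : Set X) : straddling r Tᶜ = straddling r T := by
  ext x
  simp only [straddling, Set.mem_compl_iff, not_not, Set.mem_ofPred_eq, and_comm]

theorem numBlocks_eq_ncard {r : Setoid X} {A D : Set X} (hDA : D ⊆ A)
    (hinj : ∀ x ∈ D, ∀ y ∈ D, r x y → x = y) (hex : ∀ x ∈ A, ∃ y ∈ D, r y x) :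
    numBlocks r A = D.ncard := by
  have himage : block r '' A = block r '' D := by
    refine Set.Subset.antisymm ?_ (Set.image_mono hDA)
    rintro _ ⟨x, hx, rfl⟩
    obtain ⟨y, hy, hyx⟩ := hex x hx
    exact ⟨y, hy, block_eq_block.2 hyx⟩
  rw [numBlocks, himage]
  exact Set.InjOn.ncard_image fun x hx y hy h => hinj x hx y hy (block_eq_block.1 h)

/-- The points of `T` followed by a point outside `T` along the boundary of their block. -/
def exitPoints (P : X → ℕ) (r : Setoid X) (T : Set X) : Set X :=
  {p | p ∈ T ∧ ∃ q ∉ T, boundary P Set.univ r (p, true) (q, false)}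

variable {P : X → ℕ} {r : Setoid X} {T : Set X}

theorem exists_mem_exitPoints [Finite X] (hP : Function.Injective P) (hr : Noncrossing P r)
    (hT : (∀ p ∈ T, ∀ q ∉ T, P p < P q) ∨ ∀ p ∈ T, ∀ q ∉ T, P q < P p) {x : X}
    (hx : x ∈ straddling r T) : ∃ p ∈ exitPoints P r T, r p x := by
  obtain ⟨⟨u, huT, hux⟩, v, hvT, hvx⟩ := hx
  obtain ⟨p, ⟨hpT, hpx⟩, hmax⟩ := Set.exists_max_image {u | u ∈ T ∧ r u x} P (Set.toFinite _)
    ⟨u, huT, hux⟩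
  obtain ⟨q, hpq⟩ := exists_boundary_true_false hP hr p
  refine ⟨p, ⟨hpT, q, fun hqT => ?_, hpq⟩, hpx⟩
  have hqp := hmax q ⟨hqT, r.trans' (r.symm' hpq.1) hpx⟩
  have hside := hpq.2 p trivial v trivial (r.trans' hpx (r.symm' hvx))
  simp only [chordSides_rel, precedes_true, precedes_false] at hside
  rcases hT with hT | hT
  · have := hT p hpT v hvT
    omega
  · have := hT p hpT v hvT
    have := hT q hqT v hvT
    omega

theorem eq_of_mem_exitPoints (hP : Function.Injective P)
    (hT : (∀ p ∈ T, ∀ q ∉ T, P p < P q) ∨ ∀ p ∈ T, ∀ q ∉ T, P q < P p) :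
    ∀ p ∈ exitPoints P r T, ∀ p' ∈ exitPoints P r T, r p p' → p = p' := by
  rintro p ⟨hp, q, hq, hpq⟩ p' ⟨hp', q', hq', hpq'⟩ h
  have hside := hpq.2 p trivial p' trivial h
  have hside' := hpq'.2 p trivial p' trivial h
  simp only [chordSides_rel, precedes_true, precedes_false] at hside hside'
  apply hP
  rcases hT with hT | hT <;>
  · have := hT p hp q hq
    have := hT p' hp' q hq
    have := hT p hp q' hq'
    have := hT p' hp' q' hq'
    omega

theorem numBlocks_straddling [Finite X] (hP : Function.Injective P) (hr : Noncrossing P r)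
    (hT : (∀ p ∈ T, ∀ q ∉ T, P p < P q) ∨ ∀ p ∈ T, ∀ q ∉ T, P q < P p) :
    numBlocks r (straddling r T) = (exitPoints P r T).ncard :=
  numBlocks_eq_ncard
    (fun p ⟨hp, q, hq, hpq⟩ => ⟨⟨p, hp, r.refl' p⟩, q, hq, r.symm' hpq.1⟩)
    (eq_of_mem_exitPoints hP hT) fun _ => exists_mem_exitPoints hP hr hT

end Straddling

section ThroughStrands

variable {n : ℕ}

theorem throughStrands_eq_numBlocks (r : Setoid (Fin n ⊕ Fin n)) :
    throughStrands r = numBlocks r (straddling r (Set.range Sum.inl)) := by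
  rw [throughStrands, numBlocks]
  congr 1
  ext s
  constructor
  · rintro ⟨⟨x, rfl⟩, ⟨i, hi⟩, j, hj⟩
    exact ⟨x, ⟨⟨_, ⟨i, rfl⟩, hi⟩, Sum.inr j, by simp, hj⟩, rfl⟩
  · rintro ⟨x, ⟨⟨_, ⟨i, rfl⟩, hi⟩, i' | j, hj, hjx⟩, rfl⟩
    · exact absurd ⟨i', rfl⟩ hj
    · exact ⟨⟨x, rfl⟩, ⟨i, hi⟩, j, hjx⟩

theorem numBlocks_id (n : ℕ) : numBlocks (idDiagram (Fin n)) Set.univ = n := by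
  refine (numBlocks_eq_ncard (D := Set.range Sum.inl) (Set.subset_univ _) ?_ fun x _ =>
    ⟨_, ⟨Sum.elim id id x, rfl⟩, rfl⟩).trans ?_
  · rintro _ ⟨i, rfl⟩ _ ⟨j, rfl⟩ h
    exact congrArg Sum.inl h
  · rw [Set.ncard_range_of_injective Sum.inl_injective, Nat.card_fin]

theorem throughStrands_id (n : ℕ) : throughStrands (idDiagram (Fin n)) = n := by
  have huniv : straddling (idDiagram (Fin n)) (Set.range Sum.inl) = Set.univ :=
    Set.eq_univ_of_forall fun x =>
      ⟨⟨_, ⟨Sum.elim id id x, rfl⟩, rfl⟩, Sum.inr (Sum.elim id id x), by simp, rfl⟩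
  rw [throughStrands_eq_numBlocks, huniv, numBlocks_id]

theorem throughStrands_bot : throughStrands (⊥ : Setoid (Fin n ⊕ Fin n)) = 0 := by
  have hempty : straddling ⊥ (Set.range (Sum.inl : Fin n → Fin n ⊕ Fin n)) = ∅ := by
    rw [Set.eq_empty_iff_forall_notMem]
    rintro x ⟨⟨p, hp, hpx⟩, q, hq, hqx⟩
    exact hq ((hpx.trans hqx.symm : p = q) ▸ hp)
  rw [throughStrands_eq_numBlocks, hempty, numBlocks, Set.image_empty, Set.ncard_empty]

theorem throughStrands_le (r : Setoid (Fin n ⊕ Fin n)) : throughStrands r ≤ n := by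
  have h := throughStrands_comp_le_right r (idDiagram (Fin n))
  rwa [comp_id, throughStrands_id] at h

theorem double_mem_range_inl {x : (Fin n ⊕ Fin n) × Bool} :
    double x ∈ Set.range Sum.inl ↔ x.1 ∈ Set.range Sum.inl := by
  rcases x with ⟨x | x, c⟩ <;> simp [double]

theorem pos_lt_pos_of_mem_range_inl :
    ∀ p ∈ Set.range (Sum.inl : Fin n → Fin n ⊕ Fin n), ∀ q ∉ Set.range (Sum.inl : Fin n → _),
      pos p < pos q := by
  rintro _ ⟨i, rfl⟩ (j | j) hq
  · exact absurd ⟨j, rfl⟩ hq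
  · simp only [pos]
    omega

variable {a : Setoid (Fin n ⊕ Fin n)}

theorem exists_exitPoint_of_mem_straddling_fatten {x : Fin (2 * n) ⊕ Fin (2 * n)}
    (hx : x ∈ straddling (fatten a) (Set.range Sum.inl)) :
    ∃ p ∈ exitPoints pos a (Set.range Sum.inl) ∪ exitPoints pos a (Set.range Sum.inl)ᶜ,
      fatten a (double (p, true)) x := by
  obtain ⟨⟨u', hu, hux⟩, v', hv, hvx⟩ := hx
  obtain ⟨⟨u, c⟩, rfl⟩ := double_surjective u'
  obtain ⟨⟨v, d⟩, rfl⟩ := double_surjective v'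
  rw [double_mem_range_inl] at hu hv
  have huv := fatten_double.1 (Setoid.trans' _ hux (Setoid.symm' _ hvx))
  have hcd : c ≠ d := by
    rintro rfl
    exact hv (eq_of_boundary pos_injective (Set.mem_univ u) (Set.mem_univ v) huv ▸ hu)
  cases c <;> cases d
  · exact absurd rfl hcd
  · exact ⟨v, Or.inr ⟨hv, u, not_not.2 hu, Setoid.symm' _ huv⟩, hvx⟩
  · exact ⟨u, Or.inl ⟨hu, v, hv, huv⟩, hux⟩
  · exact absurd rfl hcd

theorem double_mem_straddling_fatten {p : Fin n ⊕ Fin n}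
    (hp : p ∈ exitPoints pos a (Set.range Sum.inl) ∪ exitPoints pos a (Set.range Sum.inl)ᶜ) :
    double (p, true) ∈ straddling (fatten a) (Set.range Sum.inl) := by
  rcases hp with ⟨hp, q, hq, hpq⟩ | ⟨hp, q, hq, hpq⟩
  · exact ⟨⟨_, double_mem_range_inl.2 hp, Setoid.refl' _ _⟩, double (q, false),
      mt double_mem_range_inl.1 hq, fatten_double.2 (Setoid.symm' _ hpq)⟩
  · exact ⟨⟨double (q, false), double_mem_range_inl.2 (not_not.1 hq),
      fatten_double.2 (Setoid.symm' _ hpq)⟩, double (p, true),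
      fun h => hp (double_mem_range_inl.1 h), Setoid.refl' _ _⟩

theorem throughStrands_fatten (ha : IsPlanar a) :
    throughStrands (fatten a) = 2 * throughStrands a := by
  set D := exitPoints pos a (Set.range Sum.inl) ∪ exitPoints pos a (Set.range Sum.inl)ᶜ
  have hD : D.ncard = 2 * throughStrands a := by
    have hdisj : Disjoint (exitPoints pos a (Set.range Sum.inl))
        (exitPoints pos a (Set.range Sum.inl)ᶜ) :=
      Set.disjoint_left.2 fun p hp hp' => hp'.1 hp.1
    rw [Set.ncard_union_eq hdisj (Set.toFinite _) (Set.toFinite _),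
      ← numBlocks_straddling pos_injective ha (Or.inl pos_lt_pos_of_mem_range_inl),
      ← numBlocks_straddling (T := (Set.range Sum.inl)ᶜ) pos_injective ha
        (Or.inr fun p hp q hq => pos_lt_pos_of_mem_range_inl q (not_not.1 hq) p hp),
      straddling_compl, ← throughStrands_eq_numBlocks, two_mul]
  have hinj : Function.Injective fun p : Fin n ⊕ Fin n => double (p, true) :=
    double_injective.comp fun _ _ h => congrArg Prod.fst h
  rw [throughStrands_eq_numBlocks, ← hD, ← Set.ncard_image_of_injective D hinj]
  refine numBlocks_eq_ncard ?_ ?_ fun x hx => ?_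
  · rintro _ ⟨p, hp, rfl⟩
    exact double_mem_straddling_fatten hp
  · rintro _ ⟨p, -, rfl⟩ _ ⟨q, -, rfl⟩ h
    exact congrArg (fun p => double (p, true))
      (eq_of_boundary pos_injective (Set.mem_univ p) (Set.mem_univ q) (fatten_double.1 h))
  · obtain ⟨p, hp, hpx⟩ := exists_exitPoint_of_mem_straddling_fatten hx
    exact ⟨_, ⟨p, hp, rfl⟩, hpx⟩

end ThroughStrands

/-! ### Regularity -/

section Flip

/-- The reflection of a diagram in a horizontal line. -/
def flip {α β : Type} (a : Setoid (α ⊕ β)) : Setoid (β ⊕ α) :=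
  a.comap Sum.swap

theorem isPlanar_flip {n : ℕ} {a : Setoid (Fin n ⊕ Fin n)} (ha : IsPlanar a) :
    IsPlanar (flip a) := by
  have pos_swap : ∀ x : Fin n ⊕ Fin n, pos x.swap = 2 * n - 1 - pos x := by
    rintro (x | x) <;> simp only [pos, Sum.swap_inl, Sum.swap_inr]
    omega
  intro w x y z hwx hxy hyz hwy hxz
  have hz := pos_lt z
  have hzy : a z.swap y.swap := ha z.swap y.swap x.swap w.swap (by rw [pos_swap, pos_swap]; omega)
    (by rw [pos_swap, pos_swap]; omega) (by rw [pos_swap, pos_swap]; omega)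
    (a.symm' hxz) (a.symm' hwy)
  exact a.trans' hwy (a.trans' (a.symm' hzy) (a.symm' hxz))

variable {α β : Type} (a : Setoid (α ⊕ β))

theorem comp_flip_le : comp (flip a) a ≤ a.comap (Sum.elim Sum.inr Sum.inr) := by
  have hstack : stack (flip a) a ≤ a.comap (Sum.elim Sum.inr (Sum.elim Sum.inl Sum.inr)) :=
    stack_le (by rintro (x | x) (y | y) h <;> exact h) (by rintro (x | x) (y | y) h <;> exact h)
  rintro (x | x) (y | y) h <;> exact hstack h

theorem comp_flip_inl_inr {x : α} {y : β} (h : a (Sum.inl x) (Sum.inr y)) :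
    comp (flip a) a (Sum.inl y) (Sum.inr y) :=
  Setoid.trans' (stack (flip a) a)
    (stack_upper (flip a) a (x := Sum.inl y) (y := Sum.inr x) (a.symm' h))
    (stack_lower (flip a) a (x := Sum.inl x) (y := Sum.inr y) h)

theorem comp_comp_flip : comp a (comp (flip a) a) = a := by
  refine le_antisymm ?_ ?_
  · have hstack : stack a (comp (flip a) a) ≤
        a.comap (Sum.elim Sum.inl (Sum.elim Sum.inr Sum.inr)) :=
      stack_le (by rintro (x | x) (y | y) h <;> exact h) fun _ _ h => comp_flip_le a h
    rintro (x | x) (y | y) h <;> exact hstack h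
  · have rel_inl_inr : ∀ {x y}, a (Sum.inl x) (Sum.inr y) →
        comp a (comp (flip a) a) (Sum.inl x) (Sum.inr y) := fun {x y} h =>
      Setoid.trans' (stack a (comp (flip a) a))
        (stack_upper a (comp (flip a) a) (x := Sum.inl x) (y := Sum.inr y) h)
        (stack_lower a (comp (flip a) a) (x := Sum.inl y) (y := Sum.inr y)
          (comp_flip_inl_inr a h))
    rintro (x | x) (y | y) h
    · exact stack_upper a (comp (flip a) a) (x := Sum.inl x) (y := Sum.inl y) h
    · exact rel_inl_inr h
    · exact Setoid.symm' _ (rel_inl_inr (a.symm' h))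
    · exact stack_lower a (comp (flip a) a) (x := Sum.inr x) (y := Sum.inr y)
        (stack_lower (flip a) a (x := Sum.inr x) (y := Sum.inr y) h)

end Flip

/-! ### The embedding into the cyclic Temperley–Lieb monoid -/

section Embedding

variable {m n k l : ℕ}

theorem fatten_id (n : ℕ) : fatten (idDiagram (Fin n)) = idDiagram (Fin (2 * n)) := by
  -- `fatten` maps the identity to a left unit of its image, and that image contains the identity.
  have hpl : IsPlanar (idDiagram (Fin (2 * n))) := isPlanar_id
  have h := comp_fatten isPlanar_id (isPlanar_collapse hpl isMatching_id)
  rwa [id_comp, fatten_collapse hpl isMatching_id, comp_id] at h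

/-- The homomorphism `ℤ/m → ℤ/2m` sending `j` to `2j`. -/
def doubleResidue (m : ℕ) : ZMod m →+ ZMod (2 * m) :=
  ZMod.lift m ⟨(AddMonoidHom.mulLeft (2 : ZMod (2 * m))).comp (Int.castAddHom _),
    show (2 : ZMod (2 * m)) * ((m : ℤ) : ZMod (2 * m)) = 0 from
      mod_cast ZMod.natCast_self (2 * m)⟩

theorem doubleResidue_intCast (j : ℤ) : doubleResidue m j = 2 * (j : ZMod (2 * m)) :=
  ZMod.lift_coe m _ j

theorem doubleResidue_natCast (j : ℕ) : doubleResidue m j = 2 * (j : ZMod (2 * m)) :=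
  mod_cast doubleResidue_intCast (m := m) j

theorem doubleResidue_injective : Function.Injective (doubleResidue m) := by
  refine (injective_iff_map_eq_zero _).2 fun z hz => ?_
  obtain ⟨j, rfl⟩ := ZMod.intCast_surjective z
  rw [doubleResidue_intCast] at hz
  have h2j : ((2 * j : ℤ) : ZMod (2 * m)) = 0 := mod_cast hz
  rw [ZMod.intCast_zmod_eq_zero_iff_dvd] at h2j ⊢
  push_cast at h2j
  exact (mul_dvd_mul_iff_left two_ne_zero).1 h2j

/-- The embedding of cyclic planar partitions into cyclic Temperley–Lieb diagrams. The phase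
`2 * i + #blocks - n` turns the Euler relation `internal_fatten` into multiplicativity. -/
noncomputable def fattenCyclic (x : CyclicPartition m n) : CyclicPartition (2 * m) (2 * n) :=
  ⟨fatten x.skeleton, doubleResidue m x.bubbles + numBlocks x.skeleton Set.univ - n⟩

theorem fattenCyclic_one : fattenCyclic (1 : CyclicPartition m n) = 1 := by
  refine CyclicPartition.ext (fatten_id n) ?_
  change doubleResidue m 0 + (numBlocks (idDiagram (Fin n)) Set.univ : ZMod (2 * m)) - n = 0
  rw [numBlocks_id, map_zero, zero_add, sub_self]

theorem fattenCyclic_mul {x y : CyclicPartition m n} (hx : IsPlanar x.skeleton)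
    (hy : IsPlanar y.skeleton) : fattenCyclic (x * y) = fattenCyclic x * fattenCyclic y := by
  refine CyclicPartition.ext (comp_fatten hx hy).symm ?_
  have heuler := congrArg (Nat.cast : ℕ → ZMod (2 * m)) (internal_fatten hx hy)
  push_cast at heuler
  change doubleResidue m (x.bubbles + y.bubbles + (internal x.skeleton y.skeleton : ZMod m)) +
      (numBlocks (comp x.skeleton y.skeleton) Set.univ : ZMod (2 * m)) - n =
    (doubleResidue m x.bubbles + (numBlocks x.skeleton Set.univ : ZMod (2 * m)) - n) +
      (doubleResidue m y.bubbles + (numBlocks y.skeleton Set.univ : ZMod (2 * m)) - n) +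
      (internal (fatten x.skeleton) (fatten y.skeleton) : ZMod (2 * m))
  rw [map_add, map_add, doubleResidue_natCast]
  linear_combination -heuler

theorem fattenCyclic_injOn :
    Set.InjOn (fattenCyclic (m := m) (n := n)) (planarPartitionMonoid m n) := by
  intro x hx y hy h
  have hskeleton : x.skeleton = y.skeleton :=
    fatten_injOn hx hy (congrArg CyclicPartition.skeleton h)
  have hbubbles : doubleResidue m x.bubbles + (numBlocks x.skeleton Set.univ : ZMod (2 * m)) - n =
      doubleResidue m y.bubbles + (numBlocks y.skeleton Set.univ : ZMod (2 * m)) - n :=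
    congrArg CyclicPartition.bubbles h
  rw [hskeleton, sub_left_inj, add_left_inj] at hbubbles
  exact CyclicPartition.ext hskeleton (doubleResidue_injective hbubbles)

/-- `fattenCyclic`, restricted to the identity and the diagrams with at most `l` through
strands. -/
noncomputable def fattenHom (m n l : ℕ) : atMost (planarPartitionMonoid m n) l →*
    atMost (temperleyLiebMonoid (2 * m) (2 * n)) (2 * l) where
  toFun x := ⟨fattenCyclic x.1, ⟨isPlanar_fatten _, isMatching_fatten x.2.1⟩,
    x.2.2.imp (fun h => by rw [h, fattenCyclic_one]) fun h =>
      (throughStrands_fatten x.2.1).trans_le (Nat.mul_le_mul_left 2 h)⟩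
  map_one' := Subtype.ext fattenCyclic_one
  map_mul' x y := Subtype.ext (fattenCyclic_mul x.2.1 y.2.1)

theorem fattenHom_injective : Function.Injective (fattenHom m n l) := fun x y h =>
  Subtype.ext (fattenCyclic_injOn x.2.1 y.2.1 (congrArg Subtype.val h))

theorem throughStrands_fattenHom (x : atMost (planarPartitionMonoid m n) l) :
    throughStrands (fattenHom m n l x).1.skeleton = 2 * throughStrands x.1.skeleton :=
  throughStrands_fatten x.2.1

theorem reesCon_fattenHom {x y : atMost (planarPartitionMonoid m n) l} :
    reesCon (temperleyLiebMonoid (2 * m) (2 * n)) (2 * k) (2 * l)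
      (fattenHom m n l x) (fattenHom m n l y) ↔ reesCon (planarPartitionMonoid m n) k l x y := by
  refine or_congr fattenHom_injective.eq_iff ?_
  rw [throughStrands_fattenHom, throughStrands_fattenHom]
  omega

/-- The embedding of the truncated cyclic planar partition monoid into the truncated cyclic
Temperley–Lieb monoid. -/
noncomputable def truncationHom (m n k l : ℕ) : Truncation (planarPartitionMonoid m n) k l →*
    Truncation (temperleyLiebMonoid (2 * m) (2 * n)) (2 * k) (2 * l) :=
  Con.lift _ ((Con.mk' _).comp (fattenHom m n l)) fun _ _ h =>
    (Con.eq _).2 (reesCon_fattenHom.2 h)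

theorem truncationHom_injective : Function.Injective (truncationHom m n k l) := by
  intro s t h
  induction s using Con.induction_on with | _ x => ?_
  induction t using Con.induction_on with | _ y => ?_
  exact (Con.eq _).2 (reesCon_fattenHom.1 ((Con.eq _).1 h))

end Embedding

/-! ### Units, zero and factorizations in the truncations -/

section Factorization

variable {m n k l : ℕ} {P : Submonoid (CyclicPartition m n)}

theorem throughStrands_one : throughStrands (1 : CyclicPartition m n).skeleton = n :=
  throughStrands_id n

theorem coe_eq_one_iff {x : atMost P l} : (x : Truncation P k l) = 1 ↔ x = 1 ∨ n < k := by
  refine (Con.eq _).trans (or_congr_right ?_)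
  change _ ∧ throughStrands (1 : CyclicPartition m n).skeleton < k ↔ _
  rw [throughStrands_one]
  exact and_iff_right_of_imp (throughStrands_le _).trans_lt

theorem eq_one_of_isUnit (hl : l < n) {t : Truncation P k l} (ht : IsUnit t) : t = 1 := by
  obtain ⟨t', htt'⟩ := ht.exists_right_inv
  induction t using Con.induction_on with | _ x => ?_
  induction t' using Con.induction_on with | _ y => ?_
  rw [← Con.coe_mul, coe_eq_one_iff] at htt'
  refine coe_eq_one_iff.2 (htt'.imp_left fun hxy => ?_)
  refine Subtype.ext (x.2.2.resolve_right fun hx => ?_)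
  have hle := throughStrands_comp_le_left x.1.skeleton y.1.skeleton
  rw [show comp x.1.skeleton y.1.skeleton = (1 : CyclicPartition m n).skeleton from
    congrArg (fun z : atMost P l => z.1.skeleton) hxy, throughStrands_one] at hle
  omega

theorem mul_coe_eq_coe (t : Truncation P k l) {x : atMost P l}
    (hx : throughStrands x.1.skeleton < k) : t * x = x := by
  induction t using Con.induction_on with | _ y => ?_
  exact (Con.eq _).2 (Or.inr ⟨(throughStrands_comp_le_right _ _).trans_lt hx, hx⟩)

theorem exists_eq_mul_of_comp_eq_skeleton {x y : CyclicPartition m n}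
    (h : comp x.skeleton y.skeleton = x.skeleton) :
    ∃ i, x = (⟨x.skeleton, i⟩ : CyclicPartition m n) * y := by
  refine ⟨x.bubbles - y.bubbles - internal x.skeleton y.skeleton, CyclicPartition.ext h.symm ?_⟩
  change x.bubbles = x.bubbles - y.bubbles - internal x.skeleton y.skeleton + y.bubbles +
    internal x.skeleton y.skeleton
  ring

theorem exists_eq_mul_fattenHom (hl : l < n)
    {y : atMost (temperleyLiebMonoid (2 * m) (2 * n)) (2 * l)} (hy : y ≠ 1) :
    ∃ y' x, x ≠ 1 ∧ y = y' * fattenHom m n l x := by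
  obtain ⟨⟨s, c⟩, ⟨hs, hm⟩, hthrough⟩ := y
  obtain ⟨a, ha, rfl⟩ : ∃ a, IsPlanar a ∧ fatten a = s :=
    ⟨_, isPlanar_collapse hs hm, fatten_collapse hs hm⟩
  replace hthrough : throughStrands (fatten a) ≤ 2 * l :=
    hthrough.resolve_left fun h => hy (Subtype.ext h)
  have hal : throughStrands (comp (flip a) a) ≤ l := by
    rw [throughStrands_fatten ha] at hthrough
    exact (throughStrands_comp_le_right _ _).trans (by omega)
  have hplanar : IsPlanar (comp (flip a) a) := (isPlanar_flip ha).comp ha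
  let x : atMost (planarPartitionMonoid m n) l :=
    ⟨⟨comp (flip a) a, 0⟩, hplanar, Or.inr hal⟩
  have hcomp : comp (fatten a) (fatten (comp (flip a) a)) = fatten a := by
    rw [comp_fatten ha hplanar, comp_comp_flip]
  obtain ⟨i, hi⟩ := exists_eq_mul_of_comp_eq_skeleton (x := ⟨fatten a, c⟩)
    (y := fattenCyclic x.1) hcomp
  refine ⟨⟨⟨fatten a, i⟩, ⟨hs, hm⟩, Or.inr hthrough⟩, x, fun hx => ?_, Subtype.ext hi⟩
  have hone : comp (flip a) a = (1 : CyclicPartition m n).skeleton :=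
    congrArg (fun z : atMost (planarPartitionMonoid m n) l => z.1.skeleton) hx
  rw [hone, throughStrands_one] at hal
  omega

theorem exists_eq_mul_truncationHom (hl : l < n)
    {t : Truncation (temperleyLiebMonoid (2 * m) (2 * n)) (2 * k) (2 * l)} (ht : t ≠ 1) :
    ∃ t' s, s ≠ 1 ∧ t = t' * truncationHom m n k l s := by
  induction t using Con.induction_on with | _ y => ?_
  rw [Ne, coe_eq_one_iff, not_or] at ht
  obtain ⟨y', x, hx, rfl⟩ := exists_eq_mul_fattenHom hl ht.1
  exact ⟨y', x, fun h => hx ((coe_eq_one_iff.1 h).resolve_right (by omega)), rfl⟩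

theorem isPlanar_bot : IsPlanar (⊥ : Setoid (Fin n ⊕ Fin n)) := by
  rintro w x y z hwx hxy - h -
  exact absurd (congrArg pos (show w = y from h)) (hwx.trans hxy).ne

/-- The diagram all of whose blocks are singletons; its image in a truncation is the zero
element. -/
def singletons (m n l : ℕ) : atMost (planarPartitionMonoid m n) l :=
  ⟨⟨⊥, 0⟩, isPlanar_bot, Or.inr (throughStrands_bot.trans_le l.zero_le)⟩

theorem mul_truncationHom_singletons (hk : 1 ≤ k)
    (t : Truncation (temperleyLiebMonoid (2 * m) (2 * n)) (2 * k) (2 * l)) :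
    t * truncationHom m n k l (singletons m n l) = truncationHom m n k l (singletons m n l) := by
  refine mul_coe_eq_coe t (x := fattenHom m n l (singletons m n l)) ?_
  rw [throughStrands_fattenHom, show throughStrands (singletons m n l).1.skeleton = 0 from
    throughStrands_bot]
  omega

end Factorization

end CyclicDiagram

namespace RepGap

universe u v w

/-! ### Representations trivial on a submonoid -/

theorem IsExceptional.eq_of_ne_one {T : Type v} [Monoid T] (hT : IsExceptional T) {s t : T}
    (hs : s ≠ 1) (ht : t ≠ 1) : s = t := by
  rcases hT with ⟨⟨e⟩⟩ | ⟨⟨e⟩⟩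
  · exact e.injective (Subsingleton.elim _ _)
  · have apply_eq_zero : ∀ {t}, t ≠ 1 → e t = 0 := fun {t} ht => by
      by_contra h0
      obtain ⟨c, hc⟩ := WithZero.ne_zero_iff_exists.1 h0
      exact ht (e.injective (hc.symm.trans e.map_one.symm))
    exact e.injective ((apply_eq_zero hs).trans (apply_eq_zero ht).symm)

theorem IsExceptional.of_injective {S : Type v} {T : Type w} [Monoid S] [Monoid T] (f : S →* T)
    (hf : Function.Injective f) (hT : IsExceptional T) : IsExceptional S := by
  by_cases hS : ∀ s : S, s = 1
  · have : Unique S := ⟨⟨1⟩, hS⟩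
    exact Or.inl ⟨MulEquiv.ofUnique⟩
  push Not at hS
  obtain ⟨s, hs⟩ := hS
  have hfs : f s ≠ 1 := fun h => hs (hf (h.trans f.map_one.symm))
  have hsurj : Function.Surjective f := fun t => by
    by_cases ht : t = 1
    · exact ⟨1, f.map_one.trans ht.symm⟩
    · exact ⟨s, hT.eq_of_ne_one hfs ht⟩
  let e : S ≃* T := MulEquiv.ofBijective f ⟨hf, hsurj⟩
  exact hT.imp (fun ⟨g⟩ => ⟨e.trans g⟩) fun ⟨g⟩ => ⟨e.trans g⟩

/-- A vector fixed by the zero `f z` is fixed by everything, and a vector killed by the image of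
the non-identity elements of `S` is killed by all non-identity elements of `T`. -/
theorem IsTrivialUpTo.of_injective {K : Type u} [Field K] {S : Type v} {T : Type w} [Monoid S]
    [Monoid T] (f : S →* T) (hf : Function.Injective f) {z : S} (hz : ∀ t, t * f z = f z)
    (hunit : ∀ t : T, IsUnit t → t = 1)
    (hfactor : ∀ t : T, t ≠ 1 → ∃ t' s, s ≠ 1 ∧ t = t' * f s) {d : ℤ}
    (h : IsTrivialUpTo K S d) : IsTrivialUpTo K T d := by
  refine ⟨fun hT => h.1 (hT.of_injective f hf), fun V _ _ _ ρ hV => ?_⟩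
  obtain ⟨e, b, hb⟩ := h.2 V (ρ.comp f) hV
  refine ⟨e, b, fun i => ?_⟩
  rcases hb i with hfixed | hkilled
  · refine Or.inl fun t => ?_
    calc ρ t (b i) = ρ t (ρ (f z) (b i)) := congrArg (ρ t) (hfixed z).symm
      _ = ρ (t * f z) (b i) := by rw [map_mul, Module.End.mul_apply]
      _ = b i := by rw [hz]; exact hfixed z
  · refine Or.inr fun t => ⟨fun ht => by rw [hunit t ht, map_one, Module.End.one_apply],
      fun ht => ?_⟩
    obtain ⟨t', s, hs, rfl⟩ := hfactor t fun h => ht (h ▸ isUnit_one)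
    have hfs : ρ (f s) (b i) = 0 :=
      (hkilled s).2 fun hs_unit => hs (hf ((hunit _ (hs_unit.map f)).trans f.map_one.symm))
    rw [map_mul, Module.End.mul_apply, hfs, map_zero]

theorem gap_le_of_injective (K : Type u) [Field K] {S : Type v} {T : Type w} [Monoid S]
    [Monoid T] (f : S →* T) (hf : Function.Injective f) {z : S} (hz : ∀ t, t * f z = f z)
    (hunit : ∀ t : T, IsUnit t → t = 1)
    (hfactor : ∀ t : T, t ≠ 1 → ∃ t' s, s ≠ 1 ∧ t = t' * f s) : gap K S ≤ gap K T := by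
  refine sSup_le_sSup ?_
  rintro _ ⟨d, rfl, hd⟩
  exact ⟨d, rfl, hd.of_injective f hf hz hunit hfactor⟩

end RepGap

theorem mainTheorem9_general {K : Type*} [Field K] (m n k l : ℕ) (hk : 1 ≤ k) (hln : l < n) :
    RepGap.gap K
        (CyclicDiagram.Truncation (CyclicDiagram.planarPartitionMonoid m n) k l) ≤
      RepGap.gap K
        (CyclicDiagram.Truncation
          (CyclicDiagram.temperleyLiebMonoid (2 * m) (2 * n)) (2 * k) (2 * l)) :=
  RepGap.gap_le_of_injective K (CyclicDiagram.truncationHom m n k l)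
    CyclicDiagram.truncationHom_injective (CyclicDiagram.mul_truncationHom_singletons hk)
    (fun _ => CyclicDiagram.eq_one_of_isUnit (by omega))
    (fun _ => CyclicDiagram.exists_eq_mul_truncationHom hln)

theorem mainTheorem9 {K : Type*} [Field K] (m n k l : ℕ) (hk : 1 ≤ k) (hkl : k ≤ l) (hln : l < n)
    (hK : ¬ ringChar K ∣ 2 * m) :
    RepGap.gap K
        (CyclicDiagram.Truncation (CyclicDiagram.planarPartitionMonoid m n) k l) ≤
      RepGap.gap K
        (CyclicDiagram.Truncation
          (CyclicDiagram.temperleyLiebMonoid (2 * m) (2 * n)) (2 * k) (2 * l)) :=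
  mainTheorem9_general m n k l hk hln
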